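/- **Theorem 1 (transfer-matrix formula).** *Conventions.* Cells are elements $(i,j)$ of $\mathbb{Z}^2$, in row $i$ and column $j$; rows are numbered from top to bottom, columns from left to right, and $\mathbb{N}=\{1,2,\dots\}$. A partial tableau of a finite shape $S\subseteq\mathbb{Z}^2$ is an injective map $\tau:S\to\mathbb{N}$ with $\tau(i,j)<\tau(i,j+1)$ and $\tau(i,j)<\tau(i+1,j)$ whenever both cells lie in $S$; it is a standard Young tableau, $\tau\in SYT(S)$, if all entries lie in $\{1,\dots,|S|\}$. The tableau graph $Tb(\tau)$ has vertex set $S$ and an edge $\{(i_1,j_1),(i_2,j_2)\}$ whenever $i_1>i_2$, $j_1<j_2$ and $\tau(i_1,j_1)<\tau(i_2,j_2)$. We write $\tau\cong\tau'$ if some translation of $\mathbb{Z}^2$ carries $Tb(\tau)$ onto $Tb(\tau')$. *Periodic shapes.* A periodic shape is a finite set $P\subseteq\mathbb{Z}^2$ that contains $(1,1)$, is a skew shape $\lambda/\mu$ in French notation (rows $1,\dots,m$ from top to bottom, row $m+1-k$ consisting of the cells in columns $\mu_k+1,\dots,\lambda_k$, for partitions $\mu\subseteq\lambda$), is connected through horizontally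 and vertically adjacent cells, and is such that every column other than the left-most and the right-most one contains a cell $(i,j)\in P$ with $(i,j-1),(i,j+1)\in P$. For an integer $w\ge 0$ let $\nabla=b-a+(1,w)$, where $a$ and $b$ are the left-most cells of the top row and of the bottom row of $P$, and let $Sh^w(P,m)=\bigcup_{i=0}^{m-1}(P+i\nabla)$. The pair $(P,w)$ is compatible if $Sh^w(P,n)$ is a periodic shape for every $n\ge1$ and the number of cells in a column of $Sh^w(P,n)$ is bounded independently of $n$ and of the column. *Index and coefficient shapes.* For a shape $S$ and $v=(i_0,j_0)\in S$ put $\Delta^S v=\{v\}\cup\{(i,j)\in S: i\le i_0,\ j>j_0\}$. For a finite non-empty shape $S$ let $\overline S$ be its translate whose top row is row $1$ and whose left-most column is column $1$. For $S=Sh^w(P,m)$ let $v$ be the left-most cell of the top row of $P+(m-1)\nabla$ and let $u=v-(1,0)+\nabla$. The index shape and the coefficient shape are $$I(P,w)=\overline{\Delta^S u},\qquad C(P,w)=\overline{\Delta^S u\cup\Delta^S(u-\nabla)\cup(P+(m-1)\nabla)}$$ for all sufficiently large $m$. Let $N(P,w)$ be the least $m$ such that some translate of $I(P,w)$ is contained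 in $Sh^w(P,m)$. *Index tableaux.* For $\tau\in SYT(C(P,w))$ let $\tau^T$ be the restriction of $\tau$ to the translate of $I(P,w)$ inside $C(P,w)$ whose top row lies in the top row, and whose left-most column lies in the left-most column, of $C(P,w)$. Let $\tau^B$ be the restriction to the translate of $I(P,w)$ inside $C(P,w)$ whose bottom row lies in the bottom row, and whose right-most column lies in the right-most column, of $C(P,w)$. For $\xi\in SYT(Sh^w(P,m))$ with $m\ge N(P,w)$ let $\xi^I$ be the restriction of $\xi$ to the translate of $I(P,w)$ inside $Sh^w(P,m)$ whose bottom row lies in the bottom row, and whose right-most column lies in the right-most column, of $Sh^w(P,m)$. *Matrix and vectors.* The tableau graph transfer matrix $M_{P,w}$ is the real matrix with rows and columns indexed by $SYT(I(P,w))$ and entries $$M_{P,w}(\tau_2,\tau_1)=\bigl|\{\tau\in SYT(C(P,w)):\tau^T\cong\tau_1,\ \tau^B\cong\tau_2\}\bigr|.$$ The vector $v_{P,w}$ has the entries $v_{P,w}(\tau)=|\{\xi\in SYT(Sh^w(P,N(P,w))):\xi^I\cong\tau\}|$ for $\tau\in SYT(I(P,w))$, and $u_{P,w}$ is the all-ones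 vector. **Statement.** Let $P$ be a periodic shape and $w\ge0$ an integer such that $(P,w)$ is compatible. Then the index shape and the coefficient shape are well defined (the shapes defining them do not depend on $m$ once $m$ is large), $N(P,w)$ exists, and for every $n\ge N(P,w)$ the number $P_w(n)=|SYT(Sh^w(P,n))|$ satisfies $$P_w(n)=u_{P,w}^{T}\,M_{P,w}^{\,n-N(P,w)}\,v_{P,w}.$$ -/

import Mathlib

open Filter

namespace PeriodicTableau

/-! Cells and shapes. A cell `(i, j)` is in row `i` and column `j`; rows are numbered from top to
bottom and columns from left to right, so a smaller first coordinate means a higher row. -/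

abbrev Cell : Type := ℤ × ℤ

abbrev Shape : Type := Finset Cell

/-- Index of the top row of a shape. -/
noncomputable def topIdx (S : Shape) : ℤ := sInf {i : ℤ | ∃ j : ℤ, (i, j) ∈ S}

/-- Index of the bottom row of a shape. -/
noncomputable def botIdx (S : Shape) : ℤ := sSup {i : ℤ | ∃ j : ℤ, (i, j) ∈ S}

/-- Index of the left-most column of a shape. -/
noncomputable def leftIdx (S : Shape) : ℤ := sInf {j : ℤ | ∃ i : ℤ, (i, j) ∈ S}

/-- Index of the right-most column of a shape. -/
noncomputable def rightIdx (S : Shape) : ℤ := sSup {j : ℤ | ∃ i : ℤ, (i, j) ∈ S}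

noncomputable def topRow (S : Shape) : Shape := S.filter fun c => c.1 = topIdx S

noncomputable def bottomRow (S : Shape) : Shape := S.filter fun c => c.1 = botIdx S

noncomputable def leftColumn (S : Shape) : Shape := S.filter fun c => c.2 = leftIdx S

noncomputable def rightColumn (S : Shape) : Shape := S.filter fun c => c.2 = rightIdx S

/-- The left-most cell in row `i` of a shape (for a row that is not empty). -/
noncomputable def leftmostCell (S : Shape) (i : ℤ) : Cell := (i, sInf {j : ℤ | (i, j) ∈ S})

/-- The translate `S + v`. -/
def translate (v : Cell) (S : Shape) : Shape := S.image fun c => c + v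

/-- Any two cells of `S` are joined by a path of cells of `S` with steps between adjacent cells. -/
def Connected (S : Shape) : Prop :=
  ∀ u ∈ S, ∀ v ∈ S, Relation.ReflTransGen
    (fun a b : Cell => b ∈ S ∧ (b - a = (1, 0) ∨ b - a = (0, 1) ∨ b - a = (-1, 0) ∨ b - a = (0, -1)))
    u v

/-- The skew shape `lam / mu` in French notation (the row of the largest parts at the bottom), placed
so that its rows are `1, 2, …` from top to bottom and its columns are `1, 2, …`. Mathlib's Young
diagrams have rows and columns numbered from `0`, row `0` having the largest part. -/
def skewShape (lam mu : YoungDiagram) : Shape :=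
  (lam.cells \ mu.cells).image fun c => ((lam.colLen 0 : ℤ) - (c.1 : ℤ), (c.2 : ℤ) + 1)

/-- Periodic shapes. -/
structure IsPeriodic (P : Shape) : Prop where
  one_mem : ((1, 1) : Cell) ∈ P
  skew : ∃ lam mu : YoungDiagram, mu ≤ lam ∧ P = skewShape lam mu
  connected : Connected P
  column : ∀ j : ℤ, (∃ i : ℤ, (i, j) ∈ P) → j ≠ leftIdx P → j ≠ rightIdx P →
    ∃ i : ℤ, (i, j) ∈ P ∧ (i, j - 1) ∈ P ∧ (i, j + 1) ∈ P

/-- The shift vector `∇_w P = b - a + (1, w)`, where `a` and `b` are the left-most cells of the top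
row and of the bottom row of `P`. -/
noncomputable def shiftVector (P : Shape) (w : ℕ) : Cell :=
  leftmostCell P (botIdx P) - leftmostCell P (topIdx P) + (1, (w : ℤ))

/-- `Sh^w(P, m)`: the union of the `m` translates `P + i ∇_w P`, `0 ≤ i < m`. -/
noncomputable def Sh (P : Shape) (w m : ℕ) : Shape :=
  (Finset.range m).biUnion fun i => translate ((i : ℤ) • shiftVector P w) P

structure Compatible (P : Shape) (w : ℕ) : Prop where
  periodic : ∀ n : ℕ, 1 ≤ n → IsPeriodic (Sh P w n)
  bounded : ∃ K : ℕ, ∀ n : ℕ, 1 ≤ n → ∀ j : ℤ, ((Sh P w n).filter fun c => c.2 = j).card ≤ K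

/-! Tableaux. -/

/-- Partial tableaux of shape `S`. -/
@[ext]
structure PartialTableau (S : Shape) where
  entry : S → ℕ
  entry_pos : ∀ c, 1 ≤ entry c
  injective : Function.Injective entry
  row_lt : ∀ (i j : ℤ) (h : (i, j) ∈ S) (h' : (i, j + 1) ∈ S), entry ⟨(i, j), h⟩ < entry ⟨(i, j + 1), h'⟩
  col_lt : ∀ (i j : ℤ) (h : (i, j) ∈ S) (h' : (i + 1, j) ∈ S), entry ⟨(i, j), h⟩ < entry ⟨(i + 1, j), h'⟩

/-- The subtableau on a subset `X` of the shape. -/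
def PartialTableau.restrict {S : Shape} (τ : PartialTableau S) (X : Shape) (hX : X ⊆ S) :
    PartialTableau X where
  entry c := τ.entry ⟨c.1, hX c.2⟩
  entry_pos c := τ.entry_pos _
  injective a b h := by
    have h1 := τ.injective h
    exact Subtype.ext (congrArg (fun z : S => z.1) h1)
  row_lt i j h h' := τ.row_lt i j (hX h) (hX h')
  col_lt i j h h' := τ.col_lt i j (hX h) (hX h')

/-- Standard Young tableaux of shape `S`: the entries lie in `{1, …, |S|}`. -/
def SYT (S : Shape) : Type := {τ : PartialTableau S // ∀ c, τ.entry c ≤ S.card}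

instance instFiniteSYT (S : Shape) : Finite (SYT S) := by
  refine Finite.of_injective
    (fun τ : SYT S => fun c : S => (⟨τ.1.entry c, Nat.lt_succ_of_le (τ.2 c)⟩ : Fin (S.card + 1))) ?_
  intro a b h
  apply Subtype.ext
  apply PartialTableau.ext
  funext c
  exact congrArg Fin.val (congrFun h c)

noncomputable instance instFintypeSYT (S : Shape) : Fintype (SYT S) := Fintype.ofFinite _

noncomputable instance instDecidableEqSYT (S : Shape) : DecidableEq (SYT S) := Classical.decEq _

/-- `P_w(n) = |SYT(Sh^w(P, n))|`. -/
noncomputable def numSYT (P : Shape) (w n : ℕ) : ℕ := Nat.card (SYT (Sh P w n))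

/-! Tableau graphs. -/

structure TableauGraph where
  V : Shape
  E : Set (Sym2 Cell)

/-- The tableau graph of a partial tableau: an edge joins two cells when one is strictly south-west
of the other and has the smaller entry. -/
def PartialTableau.graph {S : Shape} (τ : PartialTableau S) : TableauGraph where
  V := S
  E := {e | ∃ a b : S, b.1.1 < a.1.1 ∧ a.1.2 < b.1.2 ∧ τ.entry a < τ.entry b ∧ e = s(a.1, b.1)}

/-- Isomorphism of tableau graphs: a translation of `ℤ²` carrying one graph to the other. -/
def TableauGraph.Iso (G H : TableauGraph) : Prop :=
  ∃ q : Cell, translate q G.V = H.V ∧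
    ∀ a ∈ G.V, ∀ b ∈ G.V, (s(a, b) ∈ G.E ↔ s(a + q, b + q) ∈ H.E)

/-! Index shape and coefficient shape. -/

/-- The translate of `S` that lies in the quadrant of positive coordinates and touches both of its
sides. -/
noncomputable def normalize (S : Shape) : Shape := translate (1 - topIdx S, 1 - leftIdx S) S

/-- The corner of `S` generated by the cell `v`: the cell `v` itself and all cells of `S` that are
not below `v` and strictly to the right of `v`. -/
def corner (S : Shape) (v : Cell) : Shape :=
  S.filter fun c => c = v ∨ (c.1 ≤ v.1 ∧ v.2 < c.2)

/-- The last of the `m` translates of `P` that make up `Sh^w(P, m)`. -/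
noncomputable def lastPeriod (P : Shape) (w m : ℕ) : Shape :=
  translate (((m : ℤ) - 1) • shiftVector P w) P

/-- The left-most cell of the top row of the last period of `Sh^w(P, m)`. -/
noncomputable def lastCell (P : Shape) (w m : ℕ) : Cell :=
  leftmostCell (lastPeriod P w m) (topIdx (lastPeriod P w m))

/-- The cell `u` with `u - ∇_w P = v - (1, 0)`, for `v` the left-most cell of the top row of the last
period of `Sh^w(P, m)`. -/
noncomputable def baseCell (P : Shape) (w m : ℕ) : Cell :=
  lastCell P w m - (1, 0) + shiftVector P w

noncomputable def indexShapeAt (P : Shape) (w m : ℕ) : Shape :=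
  normalize (corner (Sh P w m) (baseCell P w m))

noncomputable def coeffShapeAt (P : Shape) (w m : ℕ) : Shape :=
  normalize ((corner (Sh P w m) (baseCell P w m) ∪
    corner (Sh P w m) (baseCell P w m - shiftVector P w)) ∪ lastPeriod P w m)

open Classical in
/-- The value that a sequence of shapes takes for all sufficiently large `m`. -/
noncomputable def eventualShape (f : ℕ → Shape) : Shape :=
  if h : ∃ T, ∀ᶠ m in atTop, f m = T then h.choose else ∅

/-- The index shape `I(P, w)`. -/
noncomputable def indexShape (P : Shape) (w : ℕ) : Shape := eventualShape (indexShapeAt P w)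

/-- The coefficient shape `C(P, w)`. -/
noncomputable def coeffShape (P : Shape) (w : ℕ) : Shape := eventualShape (coeffShapeAt P w)

/-- `N(P, w)`: the least `m` such that some translate of `I(P, w)` is contained in `Sh^w(P, m)`. -/
noncomputable def minPeriods (P : Shape) (w : ℕ) : ℕ :=
  sInf {m : ℕ | ∃ v : Cell, translate v (indexShape P w) ⊆ Sh P w m}

/-! Index tableaux. Below, `X` has to be a translate of the shape of `σ`, so that the row condition
and the column condition leave only one possibility for `X`. -/

/-- The top index tableau of `τ` has a tableau graph isomorphic to that of `σ`. -/
def TopIndexIso {C I : Shape} (τ : SYT C) (σ : SYT I) : Prop :=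
  ∃ (X : Shape) (hX : X ⊆ C), topRow X ⊆ topRow C ∧ leftColumn X ⊆ leftColumn C ∧
    (τ.1.restrict X hX).graph.Iso σ.1.graph

/-- The bottom index tableau of `τ` has a tableau graph isomorphic to that of `σ`. For a tableau `τ` of
shape `Sh^w(P, m)` this is the index tableau of `τ`. -/
def BottomIndexIso {C I : Shape} (τ : SYT C) (σ : SYT I) : Prop :=
  ∃ (X : Shape) (hX : X ⊆ C), bottomRow X ⊆ bottomRow C ∧ rightColumn X ⊆ rightColumn C ∧
    (τ.1.restrict X hX).graph.Iso σ.1.graph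

/-- The tableau graph transfer matrix `M_{P,w}`; rows and columns are indexed by `SYT(I(P, w))`. -/
noncomputable def transferMatrix (P : Shape) (w : ℕ) :
    Matrix (SYT (indexShape P w)) (SYT (indexShape P w)) ℝ :=
  Matrix.of fun τ₂ τ₁ =>
    (Nat.card {τ : SYT (coeffShape P w) // TopIndexIso τ τ₁ ∧ BottomIndexIso τ τ₂} : ℝ)

/-- The initial vector `v_{P,w}`. -/
noncomputable def initialVector (P : Shape) (w : ℕ) : SYT (indexShape P w) → ℝ :=
  fun τ => (Nat.card {ξ : SYT (Sh P w (minPeriods P w)) // BottomIndexIso ξ τ} : ℝ)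

/-- The all-ones vector `u_{P,w}`. -/
def onesVector (P : Shape) (w : ℕ) : SYT (indexShape P w) → ℝ := fun _ => 1

end PeriodicTableau

open PeriodicTableau

/-! A new period meets the old tableau only through the corner at the end of the strip. So the
tableaux of `Sh P w (n + 1)` are a fibre product: a tableau of `Sh P w n` and one of the coefficient
shape that agree on the index shape determine exactly one. Counting this product fibrewise
(`card_fiberProduct`) is multiplication by the transfer matrix (`IsStrip.card_bottomIndexIso_succ`),
and the formula follows by induction on the number of added periods.

Agreement on the index shape is stated through tableau graphs. In the shapes concerned, a cell
weakly north-west of another is joined to it by a path of right and down steps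
(`IsPeriodic.stepClosed`, `IsStrip.edge_stepClosed`), so the order of their entries is forced. The
edges record the order of all other pairs. Hence isomorphic graphs mean the same relative order of
all entries, that is, equal standardizations (`sameOrder_of_southWest`, `graph_iso_iff`).

For the gluing, choose coordinates in which the new period is `P` and the old ones are `P - i • d`.
The cell `(0, 1)` is an old cell directly above the first cell `(1, 1)` of `P`. Old cells outside
the corner lie weakly north-west of `(0, 1)` and have smaller entries; new cells lie weakly
south-east of `(1, 1)` and have larger ones. Every comparison between the two groups is therefore
forced, which gives both existence and uniqueness (`existsUnique_glue`).

Bounded columns force `d` to point strictly to the right, so only finitely many old periods reach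
the corner and the corner stabilizes (`IsStrip.exists_edge_eq`). A row count shows that it is
already stable as soon as a translate of it fits into the strip
(`IsStrip.edge_eq_of_translate_subset`), so the recursion is valid from `minPeriods P w` on. -/

namespace PeriodicTableau

/-! Tableaux as functions on all cells, compared by the order of their entries. -/

/-- The entries of a tableau, extended by `0`. -/
noncomputable def SYT.val {S : Shape} (τ : SYT S) (c : Cell) : ℕ :=
  if h : c ∈ S then τ.1.entry ⟨c, h⟩ else 0

/-- Only the relative order matters here: with no bound on the values, shifted, restricted and glued
fillings need no renumbering. -/
structure IsTableau (S : Shape) (f : Cell → ℕ) : Prop where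
  inj : ∀ a ∈ S, ∀ b ∈ S, f a = f b → a = b
  row_lt : ∀ c ∈ S, c + (0, 1) ∈ S → f c < f (c + (0, 1))
  col_lt : ∀ c ∈ S, c + (1, 0) ∈ S → f c < f (c + (1, 0))

def SameOrder (S : Shape) (f g : Cell → ℕ) : Prop :=
  ∀ a ∈ S, ∀ b ∈ S, (f a < f b ↔ g a < g b)

lemma SameOrder.symm {S : Shape} {f g : Cell → ℕ} (h : SameOrder S f g) : SameOrder S g f :=
  fun a ha b hb => (h a ha b hb).symm

lemma SameOrder.trans {S : Shape} {f g k : Cell → ℕ} (h : SameOrder S f g)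
    (h' : SameOrder S g k) : SameOrder S f k :=
  fun a ha b hb => (h a ha b hb).trans (h' a ha b hb)

lemma SameOrder.shift {S X : Shape} {f g : Cell → ℕ} (h : SameOrder S f g) {q : Cell}
    (hq : ∀ c ∈ X, c + q ∈ S) : SameOrder X (fun c => f (c + q)) (fun c => g (c + q)) :=
  fun a ha b hb => h _ (hq a ha) _ (hq b hb)

lemma SYT.val_of_mem {S : Shape} (τ : SYT S) {c : Cell} (h : c ∈ S) :
    τ.val c = τ.1.entry ⟨c, h⟩ := dif_pos h

lemma SYT.isTableau {S : Shape} (τ : SYT S) : IsTableau S τ.val where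
  inj a ha b hb h := by
    rw [τ.val_of_mem ha, τ.val_of_mem hb] at h
    exact congrArg Subtype.val (τ.1.injective h)
  row_lt := by
    rintro ⟨i, j⟩ h h'
    have e : ((i, j) : Cell) + (0, 1) = (i, j + 1) := by simp
    rw [e] at h' ⊢
    rw [τ.val_of_mem h, τ.val_of_mem h']
    exact τ.1.row_lt i j h h'
  col_lt := by
    rintro ⟨i, j⟩ h h'
    have e : ((i, j) : Cell) + (1, 0) = (i + 1, j) := by simp
    rw [e] at h' ⊢
    rw [τ.val_of_mem h, τ.val_of_mem h']
    exact τ.1.col_lt i j h h'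

lemma IsTableau.shift {S X : Shape} {f : Cell → ℕ} (h : IsTableau S f) {q : Cell}
    (hq : ∀ c ∈ X, c + q ∈ S) : IsTableau X (fun c => f (c + q)) where
  inj a ha b hb e := add_right_cancel (h.inj _ (hq a ha) _ (hq b hb) e)
  row_lt c hc hc' := by
    have := hq _ hc'
    rw [add_right_comm] at this
    simpa only [add_right_comm] using h.row_lt _ (hq c hc) this
  col_lt c hc hc' := by
    have := hq _ hc'
    rw [add_right_comm] at this
    simpa only [add_right_comm] using h.col_lt _ (hq c hc) this

/-- The number of cells whose entry is at most that of `c`. -/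
noncomputable def rank (S : Shape) (f : Cell → ℕ) (c : Cell) : ℕ :=
  (S.filter fun d => f d ≤ f c).card

lemma rank_lt_iff {S : Shape} {f : Cell → ℕ} {a b : Cell} (hb : b ∈ S) :
    rank S f a < rank S f b ↔ f a < f b := by
  constructor
  · intro h
    by_contra! hab
    refine absurd h (not_lt.mpr (Finset.card_le_card fun d hd => ?_))
    simp only [Finset.mem_filter] at hd ⊢
    exact ⟨hd.1, hd.2.trans hab⟩
  · intro h
    refine Finset.card_lt_card ⟨fun d hd => ?_, fun hs => ?_⟩
    · simp only [Finset.mem_filter] at hd ⊢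
      exact ⟨hd.1, hd.2.trans h.le⟩
    · have := hs (Finset.mem_filter.mpr ⟨hb, le_rfl⟩)
      simp only [Finset.mem_filter] at this
      omega

/-- Standardization: replacing each value by its rank keeps the order and makes the values at most
`S.card`. -/
lemma IsTableau.exists_syt {S : Shape} {f : Cell → ℕ} (h : IsTableau S f) :
    ∃ τ : SYT S, SameOrder S τ.val f := by
  let τ : PartialTableau S :=
    { entry := fun c => rank S f c.1
      entry_pos := fun c => Finset.card_pos.mpr ⟨c.1, Finset.mem_filter.mpr ⟨c.2, le_rfl⟩⟩
      injective := by
        intro a b e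
        apply Subtype.ext
        apply h.inj _ a.2 _ b.2
        have h1 := rank_lt_iff (f := f) (a := a.1) b.2
        have h2 := rank_lt_iff (f := f) (a := b.1) a.2
        simp only at e
        omega
      row_lt := fun i j hc hc' => (rank_lt_iff hc').mpr (by
        have e : ((i, j) : Cell) + (0, 1) = (i, j + 1) := by simp
        simpa only [e] using h.row_lt (i, j) hc (by rwa [e]))
      col_lt := fun i j hc hc' => (rank_lt_iff hc').mpr (by
        have e : ((i, j) : Cell) + (1, 0) = (i + 1, j) := by simp
        simpa only [e] using h.col_lt (i, j) hc (by rwa [e])) }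
  have hτ : ∀ c, τ.entry c ≤ S.card := fun c => Finset.card_filter_le S fun d => f d ≤ f c.1
  have hval : ∀ c ∈ S, SYT.val ⟨τ, hτ⟩ c = rank S f c := fun c hc => SYT.val_of_mem ⟨τ, hτ⟩ hc
  refine ⟨⟨τ, hτ⟩, fun a ha b hb => ?_⟩
  rw [hval a ha, hval b hb]
  exact rank_lt_iff hb

/-- The entries are distinct elements of `{1, …, |S|}`, so they exhaust this set, and exactly `x` of
them are at most a given entry `x`. Thus the order determines the tableau. -/
lemma SYT.val_eq_rank {S : Shape} (τ : SYT S) {c : Cell} (hc : c ∈ S) :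
    τ.val c = rank S τ.val c := by
  have hinj : Set.InjOn τ.val (S : Set Cell) := fun a ha b hb e => τ.isTableau.inj a ha b hb e
  have himg : S.image τ.val = Finset.Icc 1 S.card := by
    apply Finset.eq_of_subset_of_card_le
    · intro x hx
      obtain ⟨d, hd, rfl⟩ := Finset.mem_image.mp hx
      rw [τ.val_of_mem hd]
      exact Finset.mem_Icc.mpr ⟨τ.1.entry_pos _, τ.2 _⟩
    · rw [Finset.card_image_of_injOn hinj]
      simp
  have hle : τ.val c ≤ S.card := by
    rw [τ.val_of_mem hc]
    exact τ.2 _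
  have h2 : (S.filter fun d => τ.val d ≤ τ.val c).image τ.val = Finset.Icc 1 (τ.val c) := by
    ext x
    simp only [Finset.mem_image, Finset.mem_filter, Finset.mem_Icc]
    constructor
    · rintro ⟨d, ⟨hd, hdc⟩, rfl⟩
      refine ⟨?_, hdc⟩
      rw [τ.val_of_mem hd]
      exact τ.1.entry_pos _
    · rintro ⟨h1, h2⟩
      have : x ∈ S.image τ.val := by
        rw [himg]
        exact Finset.mem_Icc.mpr ⟨h1, h2.trans hle⟩
      obtain ⟨d, hd, rfl⟩ := Finset.mem_image.mp this
      exact ⟨d, ⟨hd, h2⟩, rfl⟩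
  have h3 := congrArg Finset.card h2
  rw [Finset.card_image_of_injOn (hinj.mono fun d hd => (Finset.mem_filter.mp hd).1)] at h3
  simp only [Nat.card_Icc, Nat.add_sub_cancel] at h3
  exact h3.symm

lemma SYT.ext_of_sameOrder {S : Shape} {τ σ : SYT S} (h : SameOrder S τ.val σ.val) : τ = σ := by
  apply Subtype.ext
  apply PartialTableau.ext
  funext c
  have h1 := τ.val_eq_rank c.2
  have h2 := σ.val_eq_rank c.2
  have : rank S τ.val c = rank S σ.val c := by
    unfold rank
    congr 1
    apply Finset.filter_congr
    intro d hd
    have := h c.1 c.2 d hd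
    omega
  rw [← this, ← h1, τ.val_of_mem c.2, σ.val_of_mem c.2] at h2
  exact h2.symm

/-! ### Standardized restrictions -/

/-- The standardization of the restriction of `τ` to the translate `X + q`, moved back to `X`. -/
noncomputable def SYT.pull {X S : Shape} (q : Cell) (hq : ∀ c ∈ X, c + q ∈ S) (τ : SYT S) : SYT X :=
  (τ.isTableau.shift hq).exists_syt.choose

lemma SYT.pull_spec {X S : Shape} {q : Cell} (hq : ∀ c ∈ X, c + q ∈ S) (τ : SYT S) :
    SameOrder X (τ.pull q hq).val (fun c => τ.val (c + q)) :=
  (τ.isTableau.shift hq).exists_syt.choose_spec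

lemma SYT.pull_eq_iff {X S : Shape} {q : Cell} (hq : ∀ c ∈ X, c + q ∈ S) (τ : SYT S) (σ : SYT X) :
    τ.pull q hq = σ ↔ SameOrder X σ.val (fun c => τ.val (c + q)) := by
  constructor
  · rintro rfl
    exact τ.pull_spec hq
  · intro h
    exact SYT.ext_of_sameOrder ((τ.pull_spec hq).trans h.symm)

lemma SYT.pull_pull {X Y S : Shape} {p q r : Cell} (hp : ∀ c ∈ X, c + p ∈ Y)
    (hq : ∀ c ∈ Y, c + q ∈ S) (hr : ∀ c ∈ X, c + r ∈ S) (e : p + q = r) (τ : SYT S) :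
    (τ.pull q hq).pull p hp = τ.pull r hr := by
  rw [SYT.pull_eq_iff]
  refine (τ.pull_spec hr).trans ?_
  have := ((τ.pull_spec hq).shift hp).symm
  simpa only [add_assoc, e] using this

/-! Comparable cells. -/

/-- From a cell of `S` one can step right or down inside `S` towards any cell of `S` that is weakly
south-east of it. -/
def StepClosed (S : Shape) : Prop :=
  ∀ a ∈ S, ∀ b ∈ S, a.1 ≤ b.1 → a.2 ≤ b.2 → a ≠ b →
    (a + (1, 0) ∈ S ∧ a.1 + 1 ≤ b.1) ∨ (a + (0, 1) ∈ S ∧ a.2 + 1 ≤ b.2)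

/-- Entries increase along a path of right and down steps from `a` to `b`; the induction is on the
lattice distance. -/
lemma IsTableau.lt_of_le {S : Shape} {f : Cell → ℕ} (hS : StepClosed S) (hf : IsTableau S f)
    {a b : Cell} (ha : a ∈ S) (hb : b ∈ S) (h1 : a.1 ≤ b.1) (h2 : a.2 ≤ b.2) (hab : a ≠ b) :
    f a < f b := by
  obtain ⟨n, hn⟩ : ∃ n : ℕ, (b.1 - a.1) + (b.2 - a.2) = n := ⟨_, (Int.toNat_of_nonneg (by omega)).symm⟩
  induction n generalizing a with
  | zero => exact absurd (Prod.ext (by push_cast at hn; omega) (by push_cast at hn; omega)) hab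
  | succ n ih =>
    rcases hS a ha b hb h1 h2 hab with ⟨h, hle⟩ | ⟨h, hle⟩
    · have hlt := hf.col_lt a ha h
      by_cases e : a + (1, 0) = b
      · rwa [e] at hlt
      · refine hlt.trans (ih h (by simpa using hle) (by simpa using h2) e ?_)
        simp only [Prod.fst_add, Prod.snd_add]
        push_cast at hn
        omega
    · have hlt := hf.row_lt a ha h
      by_cases e : a + (0, 1) = b
      · rwa [e] at hlt
      · refine hlt.trans (ih h (by simpa using h1) (by simpa using hle) e ?_)
        simp only [Prod.fst_add, Prod.snd_add]
        push_cast at hn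
        omega

lemma StepClosed.translate {S X : Shape} (hS : StepClosed S) (q : Cell)
    (hX : ∀ c, c ∈ X ↔ c + q ∈ S) : StepClosed X := by
  intro a ha b hb h1 h2 hab
  have := hS _ ((hX a).1 ha) _ ((hX b).1 hb) (by simpa using h1) (by simpa using h2)
    (fun e => hab (add_right_cancel e))
  simp only [Prod.fst_add, Prod.snd_add] at this
  rcases this with ⟨h, h'⟩ | ⟨h, h'⟩
  · exact Or.inl ⟨(hX _).2 (by rwa [add_right_comm]), by omega⟩
  · exact Or.inr ⟨(hX _).2 (by rwa [add_right_comm]), by omega⟩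

/-- The edges of the tableau graph fix the order of all entries. -/
lemma sameOrder_of_southWest {S : Shape} (hS : StepClosed S) {f g : Cell → ℕ}
    (hf : IsTableau S f) (hg : IsTableau S g)
    (h : ∀ a ∈ S, ∀ b ∈ S, b.1 < a.1 → a.2 < b.2 → (f a < f b ↔ g a < g b)) : SameOrder S f g := by
  intro a ha b hb
  by_cases hab : a = b
  · simp [hab]
  -- Distinct cells have distinct entries, so either direction of a comparison determines the other.
  have key : ∀ a ∈ S, ∀ b ∈ S, a ≠ b → (f a < f b ↔ g a < g b) → (f b < f a ↔ g b < g a) := by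
    intro a ha b hb hab h
    have h1 := mt (hf.inj a ha b hb) hab
    have h2 := mt (hg.inj a ha b hb) hab
    omega
  by_cases h1 : a.1 ≤ b.1 <;> by_cases h2 : a.2 ≤ b.2
  · simp [hf.lt_of_le hS ha hb h1 h2 hab, hg.lt_of_le hS ha hb h1 h2 hab]
  · by_cases h3 : a.1 = b.1
    · refine key b hb a ha (Ne.symm hab) ?_
      simp [hf.lt_of_le hS hb ha h3.ge (not_le.mp h2).le (Ne.symm hab),
        hg.lt_of_le hS hb ha h3.ge (not_le.mp h2).le (Ne.symm hab)]
    · exact key b hb a ha (Ne.symm hab) (h b hb a ha (by omega) (by omega))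
  · by_cases h3 : a.2 = b.2
    · refine key b hb a ha (Ne.symm hab) ?_
      simp [hf.lt_of_le hS hb ha (not_le.mp h1).le h3.ge (Ne.symm hab),
        hg.lt_of_le hS hb ha (not_le.mp h1).le h3.ge (Ne.symm hab)]
    · exact h a ha b hb (by omega) (by omega)
  · refine key b hb a ha (Ne.symm hab) ?_
    simp [hf.lt_of_le hS hb ha (not_le.mp h1).le (not_le.mp h2).le (Ne.symm hab),
      hg.lt_of_le hS hb ha (not_le.mp h1).le (not_le.mp h2).le (Ne.symm hab)]

/-! Extremal rows and columns. -/

lemma topIdx_eq {S : Shape} {c : Cell} (hc : c ∈ S) (h : ∀ d ∈ S, c.1 ≤ d.1) : topIdx S = c.1 :=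
  IsLeast.csInf_eq ⟨⟨c.2, hc⟩, fun _ ⟨_, hj⟩ => h _ hj⟩

lemma botIdx_eq {S : Shape} {c : Cell} (hc : c ∈ S) (h : ∀ d ∈ S, d.1 ≤ c.1) : botIdx S = c.1 :=
  IsGreatest.csSup_eq ⟨⟨c.2, hc⟩, fun _ ⟨_, hj⟩ => h _ hj⟩

lemma leftIdx_eq {S : Shape} {c : Cell} (hc : c ∈ S) (h : ∀ d ∈ S, c.2 ≤ d.2) : leftIdx S = c.2 :=
  IsLeast.csInf_eq ⟨⟨c.1, hc⟩, fun _ ⟨_, hj⟩ => h _ hj⟩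

lemma rightIdx_eq {S : Shape} {c : Cell} (hc : c ∈ S) (h : ∀ d ∈ S, d.2 ≤ c.2) : rightIdx S = c.2 :=
  IsGreatest.csSup_eq ⟨⟨c.1, hc⟩, fun _ ⟨_, hj⟩ => h _ hj⟩

lemma mem_translate {v c : Cell} {S : Shape} : c ∈ translate v S ↔ c - v ∈ S := by
  simp only [translate, Finset.mem_image]
  constructor
  · rintro ⟨d, hd, rfl⟩
    simpa using hd
  · intro h
    exact ⟨_, h, by simp⟩

/-! ### Graph isomorphism as equality of standardized restrictions -/

lemma mk_mem_graph {S : Shape} (τ : PartialTableau S) {a b : Cell} (ha : a ∈ S) (hb : b ∈ S)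
    (h1 : b.1 < a.1) (h2 : a.2 < b.2) :
    s(a, b) ∈ τ.graph.E ↔ τ.entry ⟨a, ha⟩ < τ.entry ⟨b, hb⟩ := by
  constructor
  · rintro ⟨x, y, hx, hy, hlt, e⟩
    rcases Sym2.eq_iff.mp e with ⟨rfl, rfl⟩ | ⟨rfl, rfl⟩
    · exact hlt
    · omega
  · intro h
    exact ⟨⟨a, ha⟩, ⟨b, hb⟩, h1, h2, h, rfl⟩

lemma mk_mem_graph_imp {S : Shape} (τ : PartialTableau S) {a b : Cell} (h : s(a, b) ∈ τ.graph.E) :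
    (b.1 < a.1 ∧ a.2 < b.2) ∨ (a.1 < b.1 ∧ b.2 < a.2) := by
  obtain ⟨x, y, hx, hy, -, e⟩ := h
  rcases Sym2.eq_iff.mp e with ⟨rfl, rfl⟩ | ⟨rfl, rfl⟩
  · exact Or.inl ⟨hx, hy⟩
  · exact Or.inr ⟨hx, hy⟩

lemma graph_iso_iff {C I X : Shape} (hI : StepClosed I) (hIne : I.Nonempty) {q : Cell}
    (hq : ∀ c ∈ I, c + q ∈ C) (hX : X ⊆ C) (hXI : X = translate q I) (τ : SYT C) (σ : SYT I) :
    (τ.1.restrict X hX).graph.Iso σ.1.graph ↔ τ.pull q hq = σ := by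
  have hmX : ∀ c, c ∈ I → c + q ∈ X := fun c hc => by
    rw [hXI, mem_translate]
    simpa using hc
  have hmI : ∀ c, c ∈ X → c - q ∈ I := fun c hc => by rwa [hXI, mem_translate] at hc
  have hval : ∀ c (hc : c ∈ X), (τ.1.restrict X hX).entry ⟨c, hc⟩ = τ.val c := fun c hc =>
    (τ.val_of_mem (hX hc)).symm
  rw [SYT.pull_eq_iff]
  constructor
  · rintro ⟨r, hr, hE⟩
    change translate r X = I at hr
    change ∀ a ∈ X, ∀ b ∈ X, _ at hE
    -- A non-empty finite shape has no non-zero translation symmetry: `q + r` and its negative both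
    -- preserve `I`, so neither can move a lowest or a right-most cell outwards.
    have hrq : r = -q := by
      have hsum : ∀ c, c ∈ I → c + (q + r) ∈ I := fun c hc => by
        rw [← hr, mem_translate, ← add_assoc, add_sub_cancel_right]
        exact hmX c hc
      have hsum' : ∀ c, c ∈ I → c - (q + r) ∈ I := fun c hc => by
        rw [← hr, mem_translate] at hc
        rw [add_comm, ← sub_sub]
        exact hmI _ hc
      obtain ⟨x, hx, hx'⟩ := Finset.exists_max_image I (fun c => c.1) hIne
      obtain ⟨y, hy, hy'⟩ := Finset.exists_max_image I (fun c => c.2) hIne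
      have h1 := hx' _ (hsum x hx)
      have h2 := hx' _ (hsum' x hx)
      have h3 := hy' _ (hsum y hy)
      have h4 := hy' _ (hsum' y hy)
      simp only [Prod.fst_add, Prod.snd_add, Prod.fst_sub, Prod.snd_sub] at h1 h2 h3 h4
      apply Prod.ext <;> simp <;> omega
    subst hrq
    refine sameOrder_of_southWest hI σ.isTableau (τ.isTableau.shift hq) fun a ha b hb h1 h2 => ?_
    have h := hE _ (hmX a ha) _ (hmX b hb)
    rw [mk_mem_graph _ (hmX a ha) (hmX b hb) (by simpa using h1) (by simpa using h2)] at h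
    simp only [add_neg_cancel_right] at h
    rw [mk_mem_graph _ ha hb h1 h2, hval, hval] at h
    rw [σ.val_of_mem ha, σ.val_of_mem hb]
    exact h.symm
  · intro h
    refine ⟨-q, ?_, ?_⟩
    · change translate (-q) X = I
      ext c
      rw [mem_translate, hXI, mem_translate]
      simp
    · change ∀ a ∈ X, ∀ b ∈ X, _
      have key : ∀ a ∈ X, ∀ b ∈ X, b.1 < a.1 → a.2 < b.2 →
          (s(a, b) ∈ (τ.1.restrict X hX).graph.E ↔ s(a + -q, b + -q) ∈ σ.1.graph.E) := by
        intro a ha b hb h1 h2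
        simp only [← sub_eq_add_neg]
        rw [mk_mem_graph _ ha hb h1 h2, mk_mem_graph _ (hmI a ha) (hmI b hb) (by simpa using h1)
          (by simpa using h2), hval, hval, ← σ.val_of_mem, ← σ.val_of_mem]
        have := h _ (hmI a ha) _ (hmI b hb)
        simp only [sub_add_cancel] at this
        exact this.symm
      intro a ha b hb
      by_cases hs : (b.1 < a.1 ∧ a.2 < b.2) ∨ (a.1 < b.1 ∧ b.2 < a.2)
      · rcases hs with hs | hs
        · exact key a ha b hb hs.1 hs.2
        · rw [Sym2.eq_swap, Sym2.eq_swap (a := a + -q)]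
          exact key b hb a ha hs.1 hs.2
      · constructor
        · intro h
          exact absurd (mk_mem_graph_imp _ h) hs
        · intro h
          have := mk_mem_graph_imp _ h
          simp only [Prod.fst_add, Prod.snd_add, add_lt_add_iff_right] at this
          exact absurd this hs

/-- The cells `x` and `y` witness that `I + q` touches the bottom row and the right-most column of
`C`. Touching both fixes the translation, so `X` can only be `I + q`. -/
lemma bottomIndexIso_iff {C I : Shape} (hI : StepClosed I) {q : Cell}
    (hq : ∀ c ∈ I, c + q ∈ C) {x y : Cell} (hx : x ∈ I) (hy : y ∈ I)
    (hxC : ∀ c ∈ C, c.1 ≤ (x + q).1) (hyC : ∀ c ∈ C, c.2 ≤ (y + q).2) (τ : SYT C) (σ : SYT I) :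
    BottomIndexIso τ σ ↔ τ.pull q hq = σ := by
  have hb := botIdx_eq (hq x hx) hxC
  have hr := rightIdx_eq (hq y hy) hyC
  constructor
  · rintro ⟨X, hX, h1, h2, hiso⟩
    obtain ⟨r, hXr, -⟩ := id hiso
    change translate r X = I at hXr
    have hXr' : X = translate (-r) I := by
      ext c
      rw [mem_translate, ← hXr, mem_translate]
      simp
    have hmem : ∀ c ∈ I, c - r ∈ X := fun c hc => by rwa [← hXr, mem_translate] at hc
    have hmemI : ∀ c ∈ X, c + r ∈ I := fun c hc => by
      rw [← hXr, mem_translate]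
      simpa using hc
    have hxX : ∀ d ∈ X, d.1 ≤ (x - r).1 := fun d hd => by
      have := hxC _ (hq _ (hmemI d hd))
      simp only [Prod.fst_add, Prod.fst_sub] at this ⊢
      omega
    have hyX : ∀ d ∈ X, d.2 ≤ (y - r).2 := fun d hd => by
      have := hyC _ (hq _ (hmemI d hd))
      simp only [Prod.snd_add, Prod.snd_sub] at this ⊢
      omega
    have e1 := (Finset.mem_filter.mp
      (h1 (Finset.mem_filter.mpr ⟨hmem x hx, (botIdx_eq (hmem x hx) hxX).symm⟩))).2
    have e2 := (Finset.mem_filter.mp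
      (h2 (Finset.mem_filter.mpr ⟨hmem y hy, (rightIdx_eq (hmem y hy) hyX).symm⟩))).2
    rw [hb] at e1
    rw [hr] at e2
    have hrq : -r = q := by
      simp only [Prod.fst_add, Prod.fst_sub, Prod.snd_add, Prod.snd_sub] at e1 e2
      apply Prod.ext <;> simp <;> omega
    rw [hrq] at hXr'
    exact (graph_iso_iff hI ⟨x, hx⟩ hq hX hXr' τ σ).mp hiso
  · intro h
    have hX : translate q I ⊆ C := fun c hc => by
      simpa using hq _ (mem_translate.mp hc)
    have hm : ∀ c ∈ I, c + q ∈ translate q I := fun c hc => mem_translate.mpr (by simpa using hc)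
    refine ⟨translate q I, hX, ?_, ?_, (graph_iso_iff hI ⟨x, hx⟩ hq hX rfl τ σ).mpr h⟩
    · intro c hc
      obtain ⟨h1, h2⟩ := Finset.mem_filter.mp hc
      refine Finset.mem_filter.mpr ⟨hX h1, ?_⟩
      rw [h2, hb, botIdx_eq (hm x hx) fun d hd => hxC d (hX hd)]
    · intro c hc
      obtain ⟨h1, h2⟩ := Finset.mem_filter.mp hc
      refine Finset.mem_filter.mpr ⟨hX h1, ?_⟩
      rw [h2, hr, rightIdx_eq (hm y hy) fun d hd => hyC d (hX hd)]

lemma topIndexIso_iff {C I : Shape} (hI : StepClosed I) {q : Cell}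
    (hq : ∀ c ∈ I, c + q ∈ C) {x y : Cell} (hx : x ∈ I) (hy : y ∈ I)
    (hxC : ∀ c ∈ C, (x + q).1 ≤ c.1) (hyC : ∀ c ∈ C, (y + q).2 ≤ c.2) (τ : SYT C) (σ : SYT I) :
    TopIndexIso τ σ ↔ τ.pull q hq = σ := by
  have hb := topIdx_eq (hq x hx) hxC
  have hr := leftIdx_eq (hq y hy) hyC
  constructor
  · rintro ⟨X, hX, h1, h2, hiso⟩
    obtain ⟨r, hXr, -⟩ := id hiso
    change translate r X = I at hXr
    have hXr' : X = translate (-r) I := by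
      ext c
      rw [mem_translate, ← hXr, mem_translate]
      simp
    have hmem : ∀ c ∈ I, c - r ∈ X := fun c hc => by rwa [← hXr, mem_translate] at hc
    have hmemI : ∀ c ∈ X, c + r ∈ I := fun c hc => by
      rw [← hXr, mem_translate]
      simpa using hc
    have hxX : ∀ d ∈ X, (x - r).1 ≤ d.1 := fun d hd => by
      have := hxC _ (hq _ (hmemI d hd))
      simp only [Prod.fst_add, Prod.fst_sub] at this ⊢
      omega
    have hyX : ∀ d ∈ X, (y - r).2 ≤ d.2 := fun d hd => by
      have := hyC _ (hq _ (hmemI d hd))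
      simp only [Prod.snd_add, Prod.snd_sub] at this ⊢
      omega
    have e1 := (Finset.mem_filter.mp
      (h1 (Finset.mem_filter.mpr ⟨hmem x hx, (topIdx_eq (hmem x hx) hxX).symm⟩))).2
    have e2 := (Finset.mem_filter.mp
      (h2 (Finset.mem_filter.mpr ⟨hmem y hy, (leftIdx_eq (hmem y hy) hyX).symm⟩))).2
    rw [hb] at e1
    rw [hr] at e2
    have hrq : -r = q := by
      simp only [Prod.fst_add, Prod.fst_sub, Prod.snd_add, Prod.snd_sub] at e1 e2
      apply Prod.ext <;> simp <;> omega
    rw [hrq] at hXr'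
    exact (graph_iso_iff hI ⟨x, hx⟩ hq hX hXr' τ σ).mp hiso
  · intro h
    have hX : translate q I ⊆ C := fun c hc => by
      simpa using hq _ (mem_translate.mp hc)
    have hm : ∀ c ∈ I, c + q ∈ translate q I := fun c hc => mem_translate.mpr (by simpa using hc)
    refine ⟨translate q I, hX, ?_, ?_, (graph_iso_iff hI ⟨x, hx⟩ hq hX rfl τ σ).mpr h⟩
    · intro c hc
      obtain ⟨h1, h2⟩ := Finset.mem_filter.mp hc
      refine Finset.mem_filter.mpr ⟨hX h1, ?_⟩
      rw [h2, hb, topIdx_eq (hm x hx) fun d hd => hxC d (hX hd)]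
    · intro c hc
      obtain ⟨h1, h2⟩ := Finset.mem_filter.mp hc
      refine Finset.mem_filter.mpr ⟨hX h1, ?_⟩
      rw [h2, hr, leftIdx_eq (hm y hy) fun d hd => hyC d (hX hd)]

/-! Gluing two tableaux along a common part. -/

/-- The cells of `S \ C` are below the entry of `u`, those of `C \ S` above it. -/
lemma exists_glue {S C : Shape} {f g : Cell → ℕ} {u : Cell} (hf : IsTableau S f)
    (hg : IsTableau C g) (hfg : ∀ a ∈ S, a ∈ C → ∀ b ∈ S, b ∈ C → (f a < f b ↔ g a < g b))
    (huS : u ∈ S) (huC : u ∈ C) (hlow : ∀ a ∈ S, a ∉ C → f a < f u)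
    (hhigh : ∀ b ∈ C, b ∉ S → g u < g b)
    (hadj : ∀ b ∈ C, b ∉ S → ∀ a ∈ S, a ∉ C → ¬ (b.1 ≤ a.1 ∧ b.2 ≤ a.2)) :
    ∃ h, IsTableau (S ∪ C) h ∧ SameOrder S h f ∧ SameOrder C h g := by
  classical
  have hinj : ∀ a ∈ S, a ∈ C → ∀ b ∈ S, b ∈ C → (f a = f b ↔ g a = g b) := by
    intro a ha ha' b hb hb'
    have h1 := hfg a ha ha' b hb hb'
    have h2 := hfg b hb hb' a ha ha'
    omega
  -- The entry of `u` is the threshold: `f` is used up to it, and `g`, lifted beyond `f u`, above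
  -- it. By `hlow`, cells of `S` above the threshold lie in `C`, where `g` is meaningful.
  let h : Cell → ℕ := fun c => if c ∈ S ∧ f c ≤ f u then f c else f u + 1 + g c
  have h_low : ∀ c, c ∈ S → f c ≤ f u → h c = f c := fun c h1 h2 => if_pos ⟨h1, h2⟩
  have h_high : ∀ c, c ∈ S → f u < f c → h c = f u + 1 + g c := fun c h1 h2 =>
    if_neg fun h => by omega
  have h_new : ∀ c, c ∉ S → h c = f u + 1 + g c := fun c h1 => if_neg fun h => h1 h.1
  have hS : SameOrder S h f := by
    intro a ha b hb
    have hCa : f u < f a → a ∈ C := fun hlt => by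
      by_contra hc
      have := hlow a ha hc
      omega
    have hCb : f u < f b → b ∈ C := fun hlt => by
      by_contra hc
      have := hlow b hb hc
      omega
    rcases le_or_gt (f a) (f u) with h1 | h1 <;> rcases le_or_gt (f b) (f u) with h2 | h2
    · rw [h_low a ha h1, h_low b hb h2]
    · rw [h_low a ha h1, h_high b hb h2]
      omega
    · rw [h_high a ha h1, h_low b hb h2]
      omega
    · rw [h_high a ha h1, h_high b hb h2]
      have := hfg a ha (hCa h1) b hb (hCb h2)
      omega
  have hC : SameOrder C h g := by
    have hcase : ∀ c ∈ C, (c ∈ S ∧ g c ≤ g u ∧ h c = f c ∧ f c ≤ f u) ∨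
        (g u < g c ∧ h c = f u + 1 + g c) := by
      intro c hc
      by_cases hcS : c ∈ S
      · have h1 := hfg u huS huC c hcS hc
        rcases le_or_gt (f c) (f u) with h2 | h2
        · exact Or.inl ⟨hcS, by omega, h_low c hcS h2, h2⟩
        · exact Or.inr ⟨by omega, h_high c hcS h2⟩
      · exact Or.inr ⟨hhigh c hc hcS, h_new c hcS⟩
    intro a ha b hb
    rcases hcase a ha with ⟨h1, h2, h3, h3'⟩ | ⟨h2, h3⟩ <;>
      rcases hcase b hb with ⟨h4, h5, h6, h6'⟩ | ⟨h5, h6⟩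
    · have := hfg a h1 ha b h4 hb
      omega
    · omega
    · omega
    · omega
  have hmix : ∀ a ∈ S, a ∉ C → ∀ b ∈ C, b ∉ S → h a < h b := by
    intro a ha ha' b hb hb'
    rw [h_low a ha (hlow a ha ha').le, h_new b hb']
    have := hlow a ha ha'
    omega
  have hstep : ∀ a ∈ S ∪ C, ∀ b ∈ S ∪ C, a.1 ≤ b.1 → a.2 ≤ b.2 →
      (a ∈ S → b ∈ S → f a < f b) → (a ∈ C → b ∈ C → g a < g b) → h a < h b := by
    intro a ha b hb h1 h2 hfab hgab
    by_cases h3 : a ∈ S <;> by_cases h4 : b ∈ S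
    · exact (hS a h3 b h4).2 (hfab h3 h4)
    · have hbC : b ∈ C := (Finset.mem_union.mp hb).resolve_left h4
      by_cases h5 : a ∈ C
      · exact (hC a h5 b hbC).2 (hgab h5 hbC)
      · exact hmix a h3 h5 b hbC h4
    · have haC : a ∈ C := (Finset.mem_union.mp ha).resolve_left h3
      by_cases h5 : b ∈ C
      · exact (hC a haC b h5).2 (hgab haC h5)
      · exact absurd ⟨h1, h2⟩ (hadj a haC h3 b h4 h5)
    · have haC : a ∈ C := (Finset.mem_union.mp ha).resolve_left h3
      have hbC : b ∈ C := (Finset.mem_union.mp hb).resolve_left h4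
      exact (hC a haC b hbC).2 (hgab haC hbC)
  refine ⟨h, ⟨?_, ?_, ?_⟩, hS, hC⟩
  · have hCinj : ∀ a ∈ C, ∀ b ∈ C, h a = h b → a = b := fun a ha b hb e => by
      have h1 := hC a ha b hb
      have h2 := hC b hb a ha
      exact hg.inj a ha b hb (by omega)
    intro a ha b hb e
    by_cases h3 : a ∈ S <;> by_cases h4 : b ∈ S
    · have h1 := hS a h3 b h4
      have h2 := hS b h4 a h3
      exact hf.inj a h3 b h4 (by omega)
    · have hbC : b ∈ C := (Finset.mem_union.mp hb).resolve_left h4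
      by_cases h5 : a ∈ C
      · exact hCinj a h5 b hbC e
      · have := hmix a h3 h5 b hbC h4
        omega
    · have haC : a ∈ C := (Finset.mem_union.mp ha).resolve_left h3
      by_cases h5 : b ∈ C
      · exact hCinj a haC b h5 e
      · have := hmix b h4 h5 a haC h3
        omega
    · exact hCinj a ((Finset.mem_union.mp ha).resolve_left h3) b
        ((Finset.mem_union.mp hb).resolve_left h4) e
  · intro c hc hc'
    exact hstep _ hc _ hc' (by simp) (by simp) (fun h1 h2 => hf.row_lt c h1 h2)
      fun h1 h2 => hg.row_lt c h1 h2
  · intro c hc hc'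
    exact hstep _ hc _ hc' (by simp) (by simp) (fun h1 h2 => hf.col_lt c h1 h2)
      fun h1 h2 => hg.col_lt c h1 h2

/-- Uniqueness of gluing: comparisons between `S \ C` and `C \ S` pass through the common cell `u`.
-/
lemma sameOrder_union {S C : Shape} {f g : Cell → ℕ} {u : Cell} (hS : SameOrder S f g)
    (hC : SameOrder C f g) (huS : u ∈ S) (huC : u ∈ C) (hlow : ∀ a ∈ S, a ∉ C → f a < f u)
    (hhigh : ∀ b ∈ C, b ∉ S → f u < f b) : SameOrder (S ∪ C) f g := by
  have hmix : ∀ a ∈ S, a ∉ C → ∀ b ∈ C, b ∉ S → f a < f b ∧ g a < g b := by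
    intro a ha ha' b hb hb'
    have h1 := hlow a ha ha'
    have h2 := hhigh b hb hb'
    have h3 := (hS a ha u huS).1 h1
    have h4 := (hC u huC b hb).1 h2
    omega
  intro a ha b hb
  by_cases h3 : a ∈ S <;> by_cases h4 : b ∈ S
  · exact hS a h3 b h4
  · have hbC : b ∈ C := (Finset.mem_union.mp hb).resolve_left h4
    by_cases h5 : a ∈ C
    · exact hC a h5 b hbC
    · have := hmix a h3 h5 b hbC h4
      omega
  · have haC : a ∈ C := (Finset.mem_union.mp ha).resolve_left h3
    by_cases h5 : b ∈ C
    · exact hC a haC b h5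
    · have := hmix b h4 h5 a haC h3
      omega
  · exact hC a ((Finset.mem_union.mp ha).resolve_left h3) b ((Finset.mem_union.mp hb).resolve_left h4)

/-- Tableaux of `G` correspond to compatible pairs of tableaux of `S` and of a translate `C + q`, for
`G = S ∪ (C + q)`. -/
lemma existsUnique_glue {G S C I : Shape} {q r u : Cell} (hS : ∀ c ∈ S, c + 0 ∈ G)
    (hC : ∀ c ∈ C, c + q ∈ G) (hr : ∀ c ∈ I, c + r ∈ S) (hI : ∀ c ∈ I, c + 0 ∈ C) (hrq : r = q)
    (hG : ∀ c ∈ G, c ∈ S ∨ c - q ∈ C) (hSC : ∀ c ∈ S, c - q ∈ C → c - q ∈ I) (hu : u ∈ I)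
    (hlow : ∀ f, IsTableau S f → ∀ a ∈ S, a - q ∉ C → f a < f (u + q))
    (hhigh : ∀ f, IsTableau C f → ∀ b ∈ C, b + q ∉ S → f u < f b)
    (hadj : ∀ b ∈ C, b + q ∉ S → ∀ a ∈ S, a - q ∉ C → ¬ (b.1 + q.1 ≤ a.1 ∧ b.2 + q.2 ≤ a.2))
    (ξ : SYT S) (τ : SYT C) (h : ξ.pull r hr = τ.pull 0 hI) :
    ∃! ζ : SYT G, ζ.pull 0 hS = ξ ∧ ζ.pull q hC = τ := by
  subst hrq
  have hIS : u + r ∈ S := hr u hu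
  have hIC : u ∈ C := by simpa using hI u hu
  have hGe : G = S ∪ translate r C := by
    ext c
    rw [Finset.mem_union, mem_translate]
    refine ⟨hG c, ?_⟩
    rintro (h | h)
    · simpa using hS c h
    · simpa using hC _ h
  have hmC : ∀ c ∈ translate r C, c + -r ∈ C := fun c hc => by
    rw [← sub_eq_add_neg]
    exact mem_translate.mp hc
  have hmC' : ∀ c ∈ C, c + r ∈ translate r C := fun c hc => mem_translate.mpr (by simpa using hc)
  have hso : SameOrder I (fun c => ξ.val (c + r)) τ.val := by
    refine (ξ.pull_spec hr).symm.trans ?_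
    rw [h]
    simpa using τ.pull_spec hI
  obtain ⟨k, hk, hkS, hkC⟩ := exists_glue (S := S) (C := translate r C) (f := ξ.val)
    (g := fun c => τ.val (c + -r)) (u := u + r) ξ.isTableau (τ.isTableau.shift hmC) (by
      intro a ha ha' b hb hb'
      have := hso _ (hSC a ha (mem_translate.mp ha')) _ (hSC b hb (mem_translate.mp hb'))
      simpa [sub_eq_add_neg] using this) hIS (hmC' u hIC)
    (fun a ha ha' => hlow _ ξ.isTableau a ha fun hc => ha' (mem_translate.mpr hc))
    (fun b hb hb' => by
      have := hhigh _ τ.isTableau (b + -r) (hmC b hb) (by simpa using hb')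
      simpa using this)
    (fun b hb hb' a ha ha' hab => hadj (b + -r) (hmC b hb) (by simpa using hb') a ha
      (fun hc => ha' (mem_translate.mpr hc)) (by simpa using hab))
  rw [← hGe] at hk
  obtain ⟨ζ, hζ⟩ := hk.exists_syt
  have hζS : SameOrder S ζ.val ξ.val := by
    refine SameOrder.trans ?_ hkS
    have := hζ.shift hS
    simpa using this
  have hζC : SameOrder C τ.val (fun c => ζ.val (c + r)) := by
    have h1 := hζ.shift hC
    have h2 := (hkC.shift hmC')
    simp only [add_neg_cancel_right] at h2
    exact (h1.trans h2).symm
  refine ⟨ζ, ⟨(SYT.pull_eq_iff _ _ _).2 (by simpa using hζS.symm),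
    (SYT.pull_eq_iff _ _ _).2 hζC⟩, ?_⟩
  rintro ζ' ⟨h1, h2⟩
  rw [SYT.pull_eq_iff] at h1 h2
  simp only [add_zero] at h1
  apply SYT.ext_of_sameOrder
  have key : SameOrder (S ∪ translate r C) ζ.val ζ'.val := by
    refine sameOrder_union (u := u + r) (hζS.trans h1) ?_ hIS (hmC' u hIC) ?_ ?_
    · have := (hζC.symm.trans h2).shift hmC
      simpa using this
    · intro a ha ha'
      rw [hζS a ha _ hIS]
      exact hlow _ ξ.isTableau a ha fun hc => ha' (mem_translate.mpr hc)
    · intro b hb hb'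
      have h3 := hζC u hIC _ (hmC b hb)
      simp only [neg_add_cancel_right] at h3
      rw [← h3]
      exact hhigh _ τ.isTableau (b + -r) (hmC b hb) (by simpa using hb')
  rw [← hGe] at key
  exact key.symm

/-! ### Fibre products -/

/-- Counting the points of a fibre product over the fibres of its base. -/
lemma card_fiberProduct {Z A B J : Type*} [Finite A] [Finite B] [Fintype J]
    (zA : Z → A) (zB : Z → B) (a : A → J) (t b : B → J) (hz : ∀ z, a (zA z) = t (zB z))
    (hex : ∀ x y, a x = t y → ∃! z, zA z = x ∧ zB z = y) (j : J) :
    Nat.card {z // b (zB z) = j} =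
      ∑ i, Nat.card {y // t y = i ∧ b y = j} * Nat.card {x // a x = i} := by
  have e : {z // b (zB z) = j} ≃ Σ i, {y // t y = i ∧ b y = j} × {x // a x = i} := by
    refine Equiv.ofBijective
      (fun z => ⟨a (zA z.1), ⟨zB z.1, (hz z.1).symm, z.2⟩, ⟨zA z.1, rfl⟩⟩) ⟨?_, ?_⟩
    · rintro ⟨z, hz1⟩ ⟨z', hz2⟩ h
      have h1 : zB z = zB z' := congrArg (fun s : (Σ i, {y // t y = i ∧ b y = j} × {x // a x = i}) =>
        s.2.1.1) h
      have h2 : zA z = zA z' := congrArg (fun s : (Σ i, {y // t y = i ∧ b y = j} × {x // a x = i}) =>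
        s.2.2.1) h
      exact Subtype.ext ((hex _ _ (hz z')).unique ⟨h2, h1⟩ ⟨rfl, rfl⟩)
    · rintro ⟨i, ⟨y, hy, hy'⟩, ⟨x, rfl⟩⟩
      obtain ⟨z, ⟨rfl, rfl⟩, -⟩ := hex x y hy.symm
      exact ⟨⟨z, hy'⟩, rfl⟩
  rw [Nat.card_congr e, Nat.card_sigma]
  simp only [Nat.card_prod]

/-! Skew shapes in French notation. -/

lemma mem_skewShape {lam mu : YoungDiagram} {c : Cell} :
    c ∈ skewShape lam mu ↔ ∃ k l : ℕ, (k, l) ∈ lam ∧ (k, l) ∉ mu ∧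
      c.1 = (lam.colLen 0 : ℤ) - k ∧ c.2 = (l : ℤ) + 1 := by
  simp only [skewShape, Finset.mem_image, Finset.mem_sdiff, YoungDiagram.mem_cells]
  constructor
  · rintro ⟨⟨k, l⟩, ⟨h1, h2⟩, rfl⟩
    exact ⟨k, l, h1, h2, rfl, rfl⟩
  · rintro ⟨k, l, h1, h2, h3, h4⟩
    exact ⟨(k, l), ⟨h1, h2⟩, Prod.ext h3.symm h4.symm⟩

lemma pos_of_mem_skewShape {lam mu : YoungDiagram} {c : Cell} (hc : c ∈ skewShape lam mu) :
    1 ≤ c.1 ∧ 1 ≤ c.2 := by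
  obtain ⟨k, l, h1, -, h3, h4⟩ := mem_skewShape.1 hc
  have : (k, 0) ∈ lam := lam.up_left_mem le_rfl (Nat.zero_le _) h1
  rw [YoungDiagram.mem_iff_lt_colLen] at this
  omega

/-- Young diagrams are lower sets, and in French notation north-east is the increasing direction: `c
∈ lam` puts `b` into `lam`, and `a ∉ mu` keeps `b` out of `mu`. -/
lemma skewShape_convex {lam mu : YoungDiagram} {a b c : Cell} (ha : a ∈ skewShape lam mu)
    (hc : c ∈ skewShape lam mu) (h1 : b.1 ≤ a.1) (h2 : a.2 ≤ b.2) (h3 : c.1 ≤ b.1)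
    (h4 : b.2 ≤ c.2) : b ∈ skewShape lam mu := by
  obtain ⟨k, l, -, ha2, ha3, ha4⟩ := mem_skewShape.1 ha
  obtain ⟨k', l', hc1, -, hc3, hc4⟩ := mem_skewShape.1 hc
  refine mem_skewShape.2 ⟨((lam.colLen 0 : ℤ) - b.1).toNat, (b.2 - 1).toNat, ?_, ?_, by omega,
    by omega⟩
  · exact lam.up_left_mem (by omega) (by omega) hc1
  · exact fun h => ha2 (mu.up_left_mem (by omega) (by omega) h)

lemma IsPeriodic.pos {S : Shape} (hS : IsPeriodic S) {c : Cell} (hc : c ∈ S) :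
    1 ≤ c.1 ∧ 1 ≤ c.2 := by
  obtain ⟨lam, mu, -, rfl⟩ := hS.skew
  exact pos_of_mem_skewShape hc

lemma IsPeriodic.convex {S : Shape} (hS : IsPeriodic S) {a b c : Cell} (ha : a ∈ S)
    (hc : c ∈ S) (h1 : b.1 ≤ a.1) (h2 : a.2 ≤ b.2) (h3 : c.1 ≤ b.1) (h4 : b.2 ≤ c.2) : b ∈ S := by
  obtain ⟨lam, mu, -, rfl⟩ := hS.skew
  exact skewShape_convex ha hc h1 h2 h3 h4

/-- A connected shape is not split by a corner into a north-western and a south-eastern part. -/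
lemma Connected.not_split {S : Shape} (hS : Connected S) {i j : ℤ} {a b : Cell} (ha : a ∈ S)
    (hb : b ∈ S) (ha' : a.1 ≤ i ∧ a.2 ≤ j) (hb' : i < b.1 ∧ j < b.2) :
    ∃ c ∈ S, (c.1 ≤ i ∧ j < c.2) ∨ (i < c.1 ∧ c.2 ≤ j) := by
  by_contra! hno
  have : b.1 ≤ i ∧ b.2 ≤ j := by
    have hpath := hS a ha b hb
    clear hb hb'
    induction hpath with
    | refl => exact ha'
    | @tail x y _ hxy ih =>
      obtain ⟨hy, hstep⟩ := hxy
      have h1 := hno y hy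
      rcases hstep with h | h | h | h <;> rw [sub_eq_iff_eq_add] at h <;> subst h <;>
        simp at h1 ⊢ <;> omega
  omega

/-- When `b` is strictly south-east of `a`, connectedness supplies a cell in one of the two
remaining quadrants at `a`; convexity between it and `a` yields the neighbour to the right or below.
-/
lemma IsPeriodic.stepClosed {S : Shape} (hS : IsPeriodic S) : StepClosed S := by
  intro a ha b hb h1 h2 hab
  by_cases e1 : a.1 = b.1
  · have e2 : a.2 ≠ b.2 := fun e2 => hab (Prod.ext e1 e2)
    exact Or.inr ⟨hS.convex ha hb (by simp) (by simp) (by simp; omega) (by simp; omega), by omega⟩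
  by_cases e2 : a.2 = b.2
  · exact Or.inl ⟨hS.convex hb ha (by simp; omega) (by simp; omega) (by simp) (by simp), by omega⟩
  obtain ⟨c, hc, h | h⟩ := hS.connected.not_split (i := a.1) (j := a.2) ha hb ⟨le_rfl, le_rfl⟩
    ⟨by omega, by omega⟩
  · exact Or.inr ⟨hS.convex ha hc (by simp) (by simp) (by simp; omega) (by simp; omega), by omega⟩
  · exact Or.inl ⟨hS.convex hc ha (by simp; omega) (by simp; omega) (by simp) (by simp), by omega⟩

/-- A cell that is not north-west minimal is preceded by a cell to its left or above it. -/
lemma IsPeriodic.pred_mem {S : Shape} (hS : IsPeriodic S) {a b : Cell} (ha : a ∈ S) (hb : b ∈ S)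
    (h1 : a.1 < b.1) (h2 : a.2 ≤ b.2) : b - (1, 0) ∈ S ∨ b - (0, 1) ∈ S := by
  by_cases e2 : a.2 = b.2
  · exact Or.inl (hS.convex hb ha (by simp) (by simp) (by simp; omega) (by simp; omega))
  obtain ⟨c, hc, h | h⟩ := hS.connected.not_split (i := b.1 - 1) (j := b.2 - 1) ha hb
    ⟨by omega, by omega⟩ ⟨by omega, by omega⟩
  · exact Or.inl (hS.convex hb hc (by simp) (by simp) (by simp; omega) (by simp; omega))
  · exact Or.inr (hS.convex hc hb (by simp; omega) (by simp; omega) (by simp) (by simp))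

/-! The unions of translates of a period. -/

/-- The geometry of a compatible pair: `d` is the shift vector of the period `P`. -/
structure IsStrip (P : Shape) (w : ℕ) (d : Cell) : Prop where
  shift : shiftVector P w = d
  one_mem : ((1, 1) : Cell) ∈ P
  pos : ∀ c ∈ P, 1 ≤ c.1 ∧ 1 ≤ c.2
  row_le : ∀ c ∈ P, c.1 ≤ d.1
  col_pos : 1 ≤ d.2
  stepClosed : ∀ n : ℕ, 1 ≤ n → StepClosed (Sh P w n)
  base_mem : (0, 1) + d ∈ P

lemma mem_Sh {P : Shape} {w n : ℕ} {c : Cell} :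
    c ∈ Sh P w n ↔ ∃ i : ℕ, i < n ∧ c - (i : ℤ) • shiftVector P w ∈ P := by
  simp [Sh, mem_translate]

lemma leftmostCell_eq {S : Shape} {c : Cell} (hc : c ∈ S) (h : ∀ j, (c.1, j) ∈ S → c.2 ≤ j) :
    leftmostCell S c.1 = c :=
  Prod.ext rfl (IsLeast.csInf_eq ⟨hc, fun _ hj => h _ hj⟩)

lemma IsPeriodic.leftmostCell_topIdx {P : Shape} (hP : IsPeriodic P) (v : Cell) :
    leftmostCell (translate v P) (topIdx (translate v P)) = (1, 1) + v := by
  have hmem : (1, 1) + v ∈ translate v P := mem_translate.2 (by simpa using hP.one_mem)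
  rw [topIdx_eq hmem fun d hd => ?_]
  · refine leftmostCell_eq hmem fun j hj => ?_
    have := (hP.pos (mem_translate.1 hj)).2
    simp at this ⊢
    omega
  · have := (hP.pos (mem_translate.1 hd)).1
    simp at this ⊢
    omega

lemma Compatible.exists_isStrip {P : Shape} {w : ℕ} (hP : IsPeriodic P) (hPw : Compatible P w) :
    ∃ d, IsStrip P w d := by
  set d := shiftVector P w with hd
  have ht : leftmostCell P (topIdx P) = (1, 1) := by
    have := hP.leftmostCell_topIdx 0
    have h0 : translate 0 P = P := by ext c; simp [mem_translate]
    simpa [h0] using this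
  obtain ⟨z, hz, hz'⟩ := Finset.exists_max_image P (fun c => c.1) ⟨_, hP.one_mem⟩
  have hbot := botIdx_eq hz hz'
  have hd1 : d.1 = z.1 := by
    rw [hd, shiftVector, ht, hbot]
    simp [leftmostCell]
  have hd2 : 0 ≤ d.2 := by
    have : 1 ≤ (leftmostCell P (botIdx P)).2 := by
      rw [hbot]
      exact le_csInf ⟨z.2, hz⟩ fun j hj => (hP.pos hj).2
    rw [hd, shiftVector, ht]
    simp only [Prod.snd_add, Prod.snd_sub]
    omega
  have hz1 : 1 ≤ z.1 := (hP.pos hz).1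
  refine ⟨d, rfl, hP.one_mem, fun c hc => hP.pos hc, fun c hc => hd1 ▸ hz' c hc, ?_,
    fun n hn => (hPw.periodic n hn).stepClosed, ?_⟩
  -- If `d` were vertical, the copies of `(1, 1)` in `K + 1` periods would all lie in column `1`,
  -- exceeding the bound `K`.
  · by_contra hlt
    have hd0 : d.2 = 0 := by omega
    obtain ⟨K, hK⟩ := hPw.bounded
    have h1 := hK (K + 1) (by omega) 1
    have h2 : ((Finset.range (K + 1)).image fun i : ℕ => ((1 + i * d.1, 1) : Cell)) ⊆
        (Sh P w (K + 1)).filter fun c => c.2 = 1 := by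
      intro c hc
      obtain ⟨i, hi, rfl⟩ := Finset.mem_image.1 hc
      refine Finset.mem_filter.2 ⟨mem_Sh.2 ⟨i, Finset.mem_range.1 hi, ?_⟩, rfl⟩
      have : ((1 + i * d.1, 1) : Cell) - (i : ℤ) • shiftVector P w = (1, 1) := by
        rw [← hd]
        apply Prod.ext <;> simp [hd0]
      rw [this]
      exact hP.one_mem
    have h3 := Finset.card_le_card h2
    rw [Finset.card_image_of_injective, Finset.card_range] at h3
    · exact absurd (h3.trans h1) (by omega)
    · intro i j hij
      have : (i : ℤ) * d.1 = j * d.1 := by simpa using hij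
      exact_mod_cast mul_right_cancel₀ (by omega) this
  · have hS2 := hPw.periodic 2 (by omega)
    have hone : ((1, 1) : Cell) ∈ Sh P w 2 := hS2.one_mem
    have htwo : (1, 1) + d ∈ Sh P w 2 := mem_Sh.2 ⟨1, by omega, by simpa [← hd] using hP.one_mem⟩
    have hcase : ∀ c ∈ Sh P w 2, c ∈ P ∨ c - d ∈ P := by
      intro c hc
      obtain ⟨i, hi, h⟩ := mem_Sh.1 hc
      interval_cases i
      · exact Or.inl (by simpa using h)
      · exact Or.inr (by simpa [← hd] using h)
    -- In two periods, `(1, 1) + d` needs a predecessor. The one to its left is too low for `P` and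
    -- too far left for `P + d`; the one above is too high for `P + d`, so it belongs to `P`.
    rcases hS2.pred_mem hone htwo (by simp; omega) (by simpa using hd2) with h | h
    · have e : (1, 1) + d - (1, 0) = (0, 1) + d := by apply Prod.ext <;> simp
      rw [e] at h
      rcases hcase _ h with h | h
      · exact h
      · have := (hP.pos h).1
        simp at this
    · rcases hcase _ h with h | h
      · have := hz' _ h
        simp at this
        omega
      · have := (hP.pos h).2
        simp at this

/-- The union of the translates `P - i • d`, `1 ≤ i ≤ m`. -/
def past (P : Shape) (d : Cell) (m : ℕ) : Shape :=
  (Finset.Icc 1 m).biUnion fun i => translate (-((i : ℤ) • d)) P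

lemma mem_past {P : Shape} {d c : Cell} {m : ℕ} :
    c ∈ past P d m ↔ ∃ i : ℕ, 1 ≤ i ∧ i ≤ m ∧ c + (i : ℤ) • d ∈ P := by
  simp [past, mem_translate, and_assoc]

lemma past_mono {P : Shape} {d : Cell} {m n : ℕ} (h : m ≤ n) : past P d m ⊆ past P d n := by
  intro c hc
  obtain ⟨i, h1, h2, h3⟩ := mem_past.1 hc
  exact mem_past.2 ⟨i, h1, h2.trans h, h3⟩

lemma mem_past_succ {P : Shape} {d c : Cell} {m : ℕ} :
    c ∈ past P d (m + 1) ↔ c + d ∈ past P d m ∨ c + d ∈ P := by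
  simp only [mem_past]
  constructor
  · rintro ⟨i, h1, h2, h3⟩
    rcases h1.eq_or_lt with rfl | h1
    · exact Or.inr (by simpa using h3)
    · obtain ⟨k, rfl⟩ : ∃ k, i = k + 1 := ⟨i - 1, by omega⟩
      refine Or.inl ⟨k, by omega, by omega, ?_⟩
      convert h3 using 1
      push_cast
      module
  · rintro (⟨i, h1, h2, h3⟩ | h)
    · refine ⟨i + 1, by omega, by omega, ?_⟩
      convert h3 using 1
      push_cast
      module
    · exact ⟨1, le_rfl, by omega, by simpa using h⟩

/-- The cells of `past` that form the corner generated by `(0, 1)`. -/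
def edge (P : Shape) (d : Cell) (m : ℕ) : Shape :=
  (past P d m).filter fun c => c = (0, 1) ∨ 1 < c.2

lemma mem_edge {P : Shape} {d c : Cell} {m : ℕ} :
    c ∈ edge P d m ↔ c ∈ past P d m ∧ (c = (0, 1) ∨ 1 < c.2) := Finset.mem_filter

lemma edge_mono {P : Shape} {d : Cell} {m n : ℕ} (h : m ≤ n) : edge P d m ⊆ edge P d n :=
  Finset.filter_subset_filter _ (past_mono h)

/-! ### Normalized and eventual shapes -/

lemma normalize_eq {S : Shape} {x y : Cell} (hx : x ∈ S) (hy : y ∈ S) (hx' : ∀ c ∈ S, x.1 ≤ c.1)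
    (hy' : ∀ c ∈ S, y.2 ≤ c.2) : normalize S = translate (1 - x.1, 1 - y.2) S := by
  rw [normalize, topIdx_eq hx hx', leftIdx_eq hy hy']

lemma normalize_translate {S : Shape} (hS : S.Nonempty) (v : Cell) :
    normalize (translate v S) = normalize S := by
  obtain ⟨x, hx, hx'⟩ := Finset.exists_min_image S (fun c => c.1) hS
  obtain ⟨y, hy, hy'⟩ := Finset.exists_min_image S (fun c => c.2) hS
  rw [normalize_eq hx hy hx' hy', normalize_eq (x := x + v) (y := y + v)
    (mem_translate.2 (by simpa using hx)) (mem_translate.2 (by simpa using hy))]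
  · ext c
    simp only [mem_translate]
    rw [sub_sub]
    have : ((1 - (x + v).1, 1 - (y + v).2) : Cell) + v = (1 - x.1, 1 - y.2) := by
      apply Prod.ext <;> simp <;> ring
    rw [this]
  · intro c hc
    have := hx' _ (mem_translate.1 hc)
    simp only [Prod.fst_add, Prod.fst_sub] at this ⊢
    omega
  · intro c hc
    have := hy' _ (mem_translate.1 hc)
    simp only [Prod.snd_add, Prod.snd_sub] at this ⊢
    omega

lemma eventualShape_eq {f : ℕ → Shape} {T : Shape} (h : ∀ᶠ m in atTop, f m = T) :
    eventualShape f = T := by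
  have hex : ∃ T, ∀ᶠ m in atTop, f m = T := ⟨T, h⟩
  rw [eventualShape, dif_pos hex]
  obtain ⟨m, h1, h2⟩ := (hex.choose_spec.and h).exists
  exact h1.symm.trans h2

/-! ### Geometry of the strip and its stable corner -/

namespace IsStrip

variable {P : Shape} {w : ℕ} {d : Cell}

lemma row_pos (h : IsStrip P w d) : 1 ≤ d.1 :=
  h.row_le _ h.one_mem

/-- Renumbering the periods from the last one backwards places the end of the strip at a position
independent of `n`. -/
lemma mem_Sh_iff (h : IsStrip P w d) {n : ℕ} {c : Cell} :
    c ∈ Sh P w n ↔ c - (n : ℤ) • d ∈ past P d n := by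
  rw [mem_Sh, mem_past, h.shift]
  constructor
  · rintro ⟨i, h1, h2⟩
    refine ⟨n - i, by omega, by omega, ?_⟩
    convert h2 using 1
    push_cast [h1.le]
    module
  · rintro ⟨i, h1, h2, h3⟩
    refine ⟨n - i, by omega, ?_⟩
    convert h3 using 1
    push_cast [h2]
    module

lemma past_row_le (h : IsStrip P w d) {m : ℕ} {c : Cell} (hc : c ∈ past P d m) : c.1 ≤ 0 := by
  obtain ⟨i, h1, -, h3⟩ := mem_past.1 hc
  have h4 := h.row_le _ h3
  have h5 := h.row_pos
  simp only [Prod.fst_add, Prod.smul_fst, smul_eq_mul] at h4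
  have h6 : (1 : ℤ) ≤ i := by exact_mod_cast h1
  nlinarith

lemma mem_Sh_succ_iff (h : IsStrip P w d) {n : ℕ} {c : Cell} :
    c ∈ Sh P w (n + 1) ↔ c - (n : ℤ) • d ∈ past P d n ∨ c - (n : ℤ) • d ∈ P := by
  rw [h.mem_Sh_iff, mem_past_succ]
  have : c - ((n + 1 : ℕ) : ℤ) • d + d = c - (n : ℤ) • d := by
    push_cast
    module
  rw [this]

lemma past_stepClosed (h : IsStrip P w d) {n : ℕ} (hn : 1 ≤ n) : StepClosed (past P d n) :=
  (h.stepClosed n hn).translate ((n : ℤ) • d) fun c => by simp [h.mem_Sh_iff]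

lemma period_stepClosed (h : IsStrip P w d) : StepClosed P :=
  (h.stepClosed 1 le_rfl).translate 0 fun c => by simp [mem_Sh]

lemma corner_mem_past (h : IsStrip P w d) {m : ℕ} (hm : 1 ≤ m) : ((0, 1) : Cell) ∈ past P d m :=
  mem_past.2 ⟨1, le_rfl, hm, by simpa using h.base_mem⟩

lemma corner_mem_edge (h : IsStrip P w d) {m : ℕ} (hm : 1 ≤ m) : ((0, 1) : Cell) ∈ edge P d m :=
  mem_edge.2 ⟨h.corner_mem_past hm, Or.inl rfl⟩

/-- Right and down steps never leave the columns beyond `1`. From `(0, 1)` itself only the right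
step is possible, as no cell lies below row `0`. -/
lemma edge_stepClosed (h : IsStrip P w d) {m : ℕ} (hm : 1 ≤ m) : StepClosed (edge P d m) := by
  intro a ha b hb h1 h2 hab
  obtain ⟨ha1, ha2⟩ := mem_edge.1 ha
  obtain ⟨hb1, hb2⟩ := mem_edge.1 hb
  have hb0 := h.past_row_le hb1
  rcases h.past_stepClosed hm a ha1 b hb1 h1 h2 hab with ⟨h3, h4⟩ | ⟨h3, h4⟩
  · refine Or.inl ⟨mem_edge.2 ⟨h3, Or.inr ?_⟩, h4⟩
    rcases ha2 with rfl | ha2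
    · simp at h4
      omega
    · simpa using ha2
  · refine Or.inr ⟨mem_edge.2 ⟨h3, Or.inr ?_⟩, h4⟩
    rcases ha2 with rfl | ha2
    · simp
    · simp
      omega

lemma exists_edge_eq (h : IsStrip P w d) : ∃ R, 1 ≤ R ∧ ∀ m, R ≤ m → edge P d m = edge P d R := by
  obtain ⟨z, hz, hz'⟩ := Finset.exists_max_image P (fun c => c.2) ⟨_, h.one_mem⟩
  have hz1 := (h.pos z hz).2
  -- Each period back moves at least one column to the left, so a cell beyond column `1` in `P - i •
  -- d` forces `i ≤ z.2`, the right-most column of `P`.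
  refine ⟨z.2.toNat, by omega, fun m hm => (Finset.Subset.antisymm (edge_mono hm) ?_).symm⟩
  intro c hc
  obtain ⟨h1, h2⟩ := mem_edge.1 hc
  refine mem_edge.2 ⟨?_, h2⟩
  rcases h2 with rfl | h2
  · exact h.corner_mem_past (by omega)
  · obtain ⟨i, h3, h4, h5⟩ := mem_past.1 h1
    refine mem_past.2 ⟨i, h3, ?_, h5⟩
    have h6 := hz' _ h5
    have h7 := h.col_pos
    simp only [Prod.snd_add, Prod.smul_snd, smul_eq_mul] at h6
    have : (i : ℤ) ≤ z.2 := by nlinarith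
    omega

lemma baseCell_eq (h : IsStrip P w d) (hP : IsPeriodic P) (m : ℕ) :
    baseCell P w m = (0, 1) + (m : ℤ) • d := by
  rw [baseCell, lastCell, lastPeriod, hP.leftmostCell_topIdx, h.shift]
  have : ((1, 1) : Cell) = (0, 1) + (1, 0) := rfl
  rw [this]
  module

lemma mem_corner_iff {S : Shape} {u v c : Cell} :
    c ∈ corner S (u + v) ↔ c ∈ S ∧ (c - v = u ∨ ((c - v).1 ≤ u.1 ∧ u.2 < (c - v).2)) := by
  rw [corner, Finset.mem_filter]
  simp only [sub_eq_iff_eq_add, Prod.fst_sub, Prod.snd_sub, Prod.fst_add, Prod.snd_add,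
    sub_le_iff_le_add, lt_sub_iff_add_lt]

lemma corner_baseCell (h : IsStrip P w d) (hP : IsPeriodic P) (m : ℕ) :
    corner (Sh P w m) (baseCell P w m) = translate ((m : ℤ) • d) (edge P d m) := by
  ext c
  rw [h.baseCell_eq hP, mem_corner_iff, mem_translate, mem_edge, h.mem_Sh_iff]
  refine and_congr_right fun hc => ?_
  have := h.past_row_le hc
  simp only [this, true_and]

/-- The corner at the new base cell adds nothing: its old cells lie to the right of column `1`,
hence in the old corner, and its other cells are in the last period. -/
lemma coeff_union (h : IsStrip P w d) (hP : IsPeriodic P) (m : ℕ) :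
    (corner (Sh P w (m + 1)) (baseCell P w (m + 1)) ∪
      corner (Sh P w (m + 1)) (baseCell P w (m + 1) - shiftVector P w)) ∪ lastPeriod P w (m + 1) =
    translate ((m : ℤ) • d) (edge P d m ∪ P) := by
  ext c
  have e1 : baseCell P w (m + 1) = ((0, 1) + d) + (m : ℤ) • d := by
    rw [h.baseCell_eq hP]
    push_cast
    module
  have e2 : baseCell P w (m + 1) - shiftVector P w = (0, 1) + (m : ℤ) • d := by
    rw [e1, h.shift]
    module
  have e3 : lastPeriod P w (m + 1) = translate ((m : ℤ) • d) P := by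
    rw [lastPeriod, h.shift]
    push_cast
    simp
  rw [e2, e1, e3]
  simp only [Finset.mem_union, mem_translate, mem_corner_iff, h.mem_Sh_succ_iff, mem_edge]
  set x := c - (m : ℤ) • d
  have hd := h.col_pos
  constructor
  · rintro ((⟨h1 | h1, h2⟩ | ⟨h1 | h1, h2⟩) | h1)
    · rcases h2 with h2 | h2
      · rw [h2]
        exact Or.inr h.base_mem
      · refine Or.inl ⟨h1, Or.inr ?_⟩
        have := h2.2
        simp only [Prod.snd_add] at this
        omega
    · exact Or.inr h1
    · exact Or.inl ⟨h1, h2.imp_right And.right⟩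
    · exact Or.inr h1
    · exact Or.inr h1
  · rintro (⟨h1, h2⟩ | h1)
    · exact Or.inl (Or.inr ⟨Or.inl h1, h2.imp_right fun h2 => ⟨h.past_row_le h1, h2⟩⟩)
    · exact Or.inr h1

/-- The index shape and the coefficient shape, before the common translation that normalizes them. -/
lemma exists_shapes (h : IsStrip P w d) (hP : IsPeriodic P) : ∃ (E : Shape) (e : Cell) (R : ℕ), 1 ≤ R ∧
    (∀ m, R ≤ m → edge P d m = E) ∧
    (∀ᶠ m in atTop, indexShapeAt P w m = translate e E) ∧
    (∀ᶠ m in atTop, coeffShapeAt P w m = translate e (E ∪ P)) := by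
  obtain ⟨R, hR, hE⟩ := h.exists_edge_eq
  set E := edge P d R with hEdef
  have h0 : ((0, 1) : Cell) ∈ E := h.corner_mem_edge hR
  have hrow : ∀ c ∈ E, c.1 ≤ 0 := fun c hc => h.past_row_le (mem_edge.1 hc).1
  have hcol : ∀ c ∈ E, (1 : ℤ) ≤ c.2 := fun c hc => by
    rcases (mem_edge.1 hc).2 with rfl | h
    · simp
    · exact h.le
  obtain ⟨x, hx, hx'⟩ := Finset.exists_min_image E (fun c => c.1) ⟨_, h0⟩
  -- One translation normalizes both shapes, since `P` lies below row `0` and has no column before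
  -- `1`, the column of `(0, 1)`.
  refine ⟨E, (1 - x.1, 1 - 1), R, hR, hE, ?_, ?_⟩
  · filter_upwards [eventually_ge_atTop R] with m hm
    rw [indexShapeAt, h.corner_baseCell hP, hE m hm, normalize_translate ⟨_, h0⟩,
      normalize_eq hx h0 hx' hcol]
  · filter_upwards [eventually_ge_atTop (R + 1)] with m hm
    obtain ⟨k, rfl⟩ : ∃ k, m = k + 1 := ⟨m - 1, by omega⟩
    have h0' : ((0, 1) : Cell) ∈ E ∪ P := Finset.mem_union_left _ h0
    rw [coeffShapeAt, h.coeff_union hP, hE k (by omega), normalize_translate ⟨_, h0'⟩,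
      normalize_eq (Finset.mem_union_left _ hx) h0']
    · intro c hc
      rcases Finset.mem_union.1 hc with hc | hc
      · exact hx' c hc
      · have h1 := hrow x hx
        have h2 := (h.pos c hc).1
        omega
    · intro c hc
      rcases Finset.mem_union.1 hc with hc | hc
      · exact hcol c hc
      · exact (h.pos c hc).2

/-- If a translate of the stable corner fits into `Sh P w N`, then the corner of `Sh P w N` is
already the stable one. -/
lemma edge_eq_of_translate_subset (h : IsStrip P w d) {E : Shape} {R N n : ℕ} (hR : 1 ≤ R)
    (hE : ∀ m, R ≤ m → edge P d m = E) {v : Cell} (hv : ∀ c ∈ E, c + v ∈ Sh P w N) (hn : N ≤ n) :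
    1 ≤ N ∧ edge P d n = E := by
  have h0 : ((0, 1) : Cell) ∈ E := hE R le_rfl ▸ h.corner_mem_edge hR
  have hd := h.row_pos
  constructor
  · by_contra hN
    obtain rfl : N = 0 := by omega
    simpa [Sh] using hv _ h0
  · apply Finset.Subset.antisymm
    · rw [← hE (max R n) (le_max_left _ _)]
      exact edge_mono (le_max_right _ _)
    · intro c hc
      have hcR := mem_edge.1 (hE R le_rfl ▸ hc)
      refine mem_edge.2 ⟨?_, hcR.2⟩
      obtain ⟨i, h1, h2, h3⟩ := mem_past.1 hcR.1
      refine mem_past.2 ⟨i, h1, ?_, h3⟩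
      have h4 := h.row_le _ h3
      have h5 := h.past_row_le (h.mem_Sh_iff.1 (hv _ h0))
      obtain ⟨j, hj, h6⟩ := mem_Sh.1 (hv c hc)
      have h7 := (h.pos _ h6).1
      rw [h.shift] at h7
      simp only [Prod.fst_add, Prod.fst_sub, Prod.smul_fst, smul_eq_mul] at h4 h5 h7
      have h8 : (0 : ℤ) ≤ j * d.1 := by positivity
      -- Row count: `c` is at least `(i - 1) * d.1` rows above `(0, 1)`, whereas both cells, moved
      -- by `v`, lie within the `N * d.1` rows of the strip.
      have : (i : ℤ) < N + 1 := by nlinarith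
      omega

lemma bottomIndexIso_Sh_iff (h : IsStrip P w d) {E : Shape} {e : Cell} {n : ℕ} (hn : 1 ≤ n)
    (hE : edge P d n = E) (hq : ∀ c ∈ translate e E, c + ((n : ℤ) • d - e) ∈ Sh P w n)
    (ξ : SYT (Sh P w n)) (σ : SYT (translate e E)) :
    BottomIndexIso ξ σ ↔ ξ.pull _ hq = σ := by
  have h0 : ((0, 1) : Cell) ∈ E := hE ▸ h.corner_mem_edge hn
  obtain ⟨y, hy, hy'⟩ := Finset.exists_max_image E (fun c => c.2) ⟨_, h0⟩
  have hI : StepClosed (translate e E) :=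
    (hE ▸ h.edge_stepClosed hn : StepClosed E).translate (-e) fun c => by
      rw [mem_translate, sub_eq_add_neg]
  refine bottomIndexIso_iff hI hq (x := (0, 1) + e) (y := y + e) (mem_translate.2 (by simpa))
    (mem_translate.2 (by simpa)) ?_ ?_ ξ σ
  · intro c hc
    have := h.past_row_le (h.mem_Sh_iff.1 hc)
    simp at this ⊢
    omega
  · intro c hc
    have hc' := h.mem_Sh_iff.1 hc
    have h1 := hy' _ h0
    have : (c - (n : ℤ) • d).2 ≤ y.2 := by
      by_contra! hlt
      have := hy' _ (hE ▸ mem_edge.2 ⟨hc', Or.inr (h1.trans_lt hlt)⟩)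
      omega
    simp at this ⊢
    omega

/-! ### Adding one period -/

/-- One more period: the transfer matrix acts on the vector of the numbers of tableaux with a given
index tableau. -/
lemma card_bottomIndexIso_succ (h : IsStrip P w d) {E : Shape} {e : Cell} {n : ℕ} (hn : 1 ≤ n)
    (hE : edge P d n = E) (hE' : edge P d (n + 1) = E) (σ : SYT (translate e E)) :
    Nat.card {ξ : SYT (Sh P w (n + 1)) // BottomIndexIso ξ σ} =
      ∑ σ' : SYT (translate e E), Nat.card {τ : SYT (translate e (E ∪ P)) // TopIndexIso τ σ' ∧
        BottomIndexIso τ σ} * Nat.card {ξ : SYT (Sh P w n) // BottomIndexIso ξ σ'} := by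
  have h0 : ((0, 1) : Cell) ∈ E := hE ▸ h.corner_mem_edge hn
  have hEpast : ∀ c ∈ E, c ∈ past P d n := fun c hc => (mem_edge.1 (hE ▸ hc)).1
  have hErow : ∀ c ∈ E, c.1 ≤ 0 := fun c hc => h.past_row_le (hEpast c hc)
  have hEcol : ∀ c ∈ E, c = (0, 1) ∨ 1 < c.2 := fun c hc => (mem_edge.1 (hE ▸ hc)).2
  have hd1 := h.row_pos
  have hd2 := h.col_pos
  have hI : StepClosed (translate e E) :=
    (hE ▸ h.edge_stepClosed hn : StepClosed E).translate (-e) fun c => by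
      rw [mem_translate, sub_eq_add_neg]
  have hmI : ∀ c ∈ E, c + e ∈ translate e E := fun c hc => mem_translate.2 (by simpa)
  have hmC : ∀ c ∈ E ∪ P, c + e ∈ translate e (E ∪ P) := fun c hc =>
    mem_translate.2 (by rwa [add_sub_cancel_right])
  obtain ⟨x, hx, hx'⟩ := Finset.exists_min_image E (fun c => c.1) ⟨_, h0⟩
  obtain ⟨y, hy, hy'⟩ := Finset.exists_max_image E (fun c => c.2) ⟨_, h0⟩
  have hy1 := hy' _ h0
  set q : Cell := (n : ℤ) • d - e with hq
  have hshift : ∀ c : Cell, c + q - (n : ℤ) • d = c - e := fun c => by rw [hq]; module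
  have hshift' : ∀ c : Cell, c - q - e = c - (n : ℤ) • d := fun c => by rw [hq]; module
  have hIS : ∀ c ∈ translate e E, c + q ∈ Sh P w n := fun c hc => by
    rw [h.mem_Sh_iff, hshift]
    exact hEpast _ (mem_translate.1 hc)
  have hIG : ∀ c ∈ translate e E, c + (((n + 1 : ℕ) : ℤ) • d - e) ∈ Sh P w (n + 1) := fun c hc => by
    rw [h.mem_Sh_iff]
    have e1 : c + (((n + 1 : ℕ) : ℤ) • d - e) - ((n + 1 : ℕ) : ℤ) • d = c - e := by module
    rw [e1]
    exact past_mono (Nat.le_succ n) (hEpast _ (mem_translate.1 hc))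
  have hSG : ∀ c ∈ Sh P w n, c + 0 ∈ Sh P w (n + 1) := fun c hc => by
    rw [add_zero, h.mem_Sh_succ_iff]
    exact Or.inl (h.mem_Sh_iff.1 hc)
  have hCG : ∀ c ∈ translate e (E ∪ P), c + q ∈ Sh P w (n + 1) := fun c hc => by
    rw [h.mem_Sh_succ_iff, hshift]
    exact (Finset.mem_union.1 (mem_translate.1 hc)).imp_left (hEpast _)
  have hIC : ∀ c ∈ translate e E, c + 0 ∈ translate e (E ∪ P) := fun c hc => by
    rw [add_zero, mem_translate]
    exact Finset.mem_union_left _ (mem_translate.1 hc)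
  -- This is the bottom copy of the index shape: moved by `d`, the generating cell lands in `P`, and
  -- each other cell lands in `P` or stays an old cell beyond column `1`.
  have hIC' : ∀ c ∈ translate e E, c + d ∈ translate e (E ∪ P) := fun c hc => by
    have hc' := mem_translate.1 hc
    rw [mem_translate, add_sub_right_comm]
    rcases mem_past_succ.1 (past_mono (Nat.le_succ n) (hEpast _ hc')) with h1 | h1
    · rcases hEcol _ hc' with h2 | h2
      · rw [h2]
        exact Finset.mem_union_right _ h.base_mem
      · refine Finset.mem_union_left _ (hE ▸ mem_edge.2 ⟨h1, Or.inr ?_⟩)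
        rw [Prod.snd_add]
        omega
    · exact Finset.mem_union_right _ h1
  have htop : ∀ (τ : SYT (translate e (E ∪ P))) σ', TopIndexIso τ σ' ↔ τ.pull 0 hIC = σ' := by
    refine topIndexIso_iff hI hIC (hmI x hx) (hmI _ h0) ?_ ?_
    · intro c hc
      have : x.1 ≤ (c - e).1 := by
        rcases Finset.mem_union.1 (mem_translate.1 hc) with hc | hc
        · exact hx' _ hc
        · have h1 := hErow x hx
          have h2 := (h.pos _ hc).1
          omega
      simp at this ⊢
      omega
    · intro c hc
      have : 1 ≤ (c - e).2 := by
        rcases Finset.mem_union.1 (mem_translate.1 hc) with hc | hc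
        · rcases hEcol _ hc with hc | hc
          · rw [hc]
          · exact hc.le
        · exact (h.pos _ hc).2
      simp at this ⊢
      omega
  have hbot : ∀ (τ : SYT (translate e (E ∪ P))) σ', BottomIndexIso τ σ' ↔ τ.pull d hIC' = σ' := by
    refine bottomIndexIso_iff hI hIC' (hmI _ h0) (hmI y hy) ?_ ?_
    · intro c hc
      have : (c - e).1 ≤ d.1 := by
        rcases Finset.mem_union.1 (mem_translate.1 hc) with hc | hc
        · have := hErow _ hc
          omega
        · exact h.row_le _ hc
      simp at this ⊢
      omega
    · intro c hc
      have : (c - e).2 ≤ y.2 + d.2 := by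
        -- Moved back by `d`, such a cell would lie in the corner of `n + 1` periods, which is again
        -- `E`, beyond its right-most column.
        by_contra! hlt
        have h1 : c - e - d ∈ past P d (n + 1) := by
          rw [mem_past_succ, sub_add_cancel]
          exact (Finset.mem_union.1 (mem_translate.1 hc)).imp_left (hEpast _)
        have h2 : y.2 < (c - e - d).2 := by
          rw [Prod.snd_sub _ d]
          omega
        have := hy' _ (hE' ▸ mem_edge.2 ⟨h1, Or.inr (hy1.trans_lt h2)⟩)
        omega
      simp at this ⊢
      omega
  simp only [h.bottomIndexIso_Sh_iff (n := n + 1) (by omega) hE' hIG,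
    h.bottomIndexIso_Sh_iff hn hE hIS, htop, hbot]
  have hpp : ∀ ζ : SYT (Sh P w (n + 1)), ζ.pull _ hIG = (ζ.pull q hCG).pull d hIC' := fun ζ =>
    (SYT.pull_pull hIC' hCG hIG (by rw [hq]; push_cast; module) ζ).symm
  simp only [hpp]
  refine card_fiberProduct (SYT.pull 0 hSG) (SYT.pull q hCG) (SYT.pull q hIS) (SYT.pull 0 hIC)
    (SYT.pull d hIC') (fun ζ => ?_) (fun ξ τ hξτ => ?_) σ
  · have hIG' : ∀ c ∈ translate e E, c + q ∈ Sh P w (n + 1) := fun c hc => by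
      simpa using hSG _ (hIS c hc)
    rw [SYT.pull_pull hIS hSG hIG' (add_zero q), SYT.pull_pull hIC hCG hIG' (zero_add q)]
  · refine existsUnique_glue (u := (0, 1) + e) hSG hCG hIS hIC rfl ?_ ?_ (hmI _ h0) ?_ ?_ ?_ ξ τ hξτ
    · intro c hc
      rw [h.mem_Sh_succ_iff] at hc
      rw [h.mem_Sh_iff, mem_translate, hshift']
      exact hc.imp_right (Finset.mem_union_right _)
    · intro c hc hc'
      rw [h.mem_Sh_iff] at hc
      rw [mem_translate, hshift'] at hc' ⊢
      refine (Finset.mem_union.1 hc').resolve_right fun hP => ?_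
      have h1 := h.past_row_le hc
      have h2 := (h.pos _ hP).1
      omega
    -- Old cells outside the corner have row at most `0` and column at most `1`, so they are weakly
    -- north-west of the generating cell.
    · intro f hf a ha ha'
      rw [mem_translate, hshift'] at ha'
      have h1 := h.mem_Sh_iff.1 ha
      have h2 := h.past_row_le h1
      have h3 : ¬ ((a - (n : ℤ) • d) = (0, 1) ∨ 1 < (a - (n : ℤ) • d).2) := fun h3 =>
        ha' (Finset.mem_union_left _ (hE ▸ mem_edge.2 ⟨h1, h3⟩))
      push Not at h3
      have e1 : (0, 1) + e + q = (0, 1) + (n : ℤ) • d := by rw [hq]; module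
      refine hf.lt_of_le (h.stepClosed n hn) ha (hIS _ (hmI _ h0)) ?_ ?_ ?_
      · rw [e1]
        simp at h2 ⊢
        omega
      · rw [e1]
        have := h3.2
        simp at this ⊢
        omega
      · rw [e1]
        exact fun h4 => h3.1 (by rw [h4, add_sub_cancel_right])
    -- The generating cell is directly above the first cell of the new period, which is weakly
    -- north-west of all new cells.
    · intro f hf b hb hb'
      rw [h.mem_Sh_iff, hshift] at hb'
      have hbP : b - e ∈ P := (Finset.mem_union.1 (mem_translate.1 hb)).resolve_left
        fun hbE => hb' (hEpast _ hbE)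
      have hone := hmC _ (Finset.mem_union_right _ h.one_mem)
      have e1 : (0, 1) + e + (1, 0) = (1, 1) + e := by
        apply Prod.ext <;> simp
        ring
      have h1 := hf.col_lt _ (hmC _ (Finset.mem_union_left _ h0)) (by rwa [e1])
      rw [e1] at h1
      by_cases hbe : (1, 1) = b - e
      · rwa [hbe, sub_add_cancel] at h1
      · have hf' : IsTableau P fun c => f (c + e) :=
          hf.shift fun c hc => hmC c (Finset.mem_union_right _ hc)
        have h2 := hf'.lt_of_le h.period_stepClosed h.one_mem hbP (h.pos _ hbP).1 (h.pos _ hbP).2 hbe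
        rw [sub_add_cancel] at h2
        exact h1.trans h2
    -- Every new cell is in a lower row than every old one.
    · rintro b hb hb' a ha - ⟨h1, -⟩
      rw [h.mem_Sh_iff, hshift] at hb'
      have hbP : b - e ∈ P := (Finset.mem_union.1 (mem_translate.1 hb)).resolve_left
        fun hbE => hb' (hEpast _ hbE)
      have h2 := (h.pos _ hbP).1
      have h3 := h.past_row_le (h.mem_Sh_iff.1 ha)
      rw [hq] at h1
      simp at h1 h2 h3
      omega

end IsStrip

end PeriodicTableau

open PeriodicTableau
theorem theorem1 (P : Shape) (w : ℕ) (hP : IsPeriodic P) (hPw : Compatible P w) :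
    (∀ᶠ m in Filter.atTop, indexShapeAt P w m = indexShape P w) ∧
    (∀ᶠ m in Filter.atTop, coeffShapeAt P w m = coeffShape P w) ∧
    IsLeast {m : ℕ | ∃ v : Cell, translate v (indexShape P w) ⊆ Sh P w m} (minPeriods P w) ∧
    ∀ n : ℕ, minPeriods P w ≤ n →
      (numSYT P w n : ℝ) =
        onesVector P w ⬝ᵥ ((transferMatrix P w) ^ (n - minPeriods P w)).mulVec (initialVector P w) := by
  obtain ⟨d, h⟩ := hPw.exists_isStrip hP
  obtain ⟨E, e, R, hR, hE, hI, hC⟩ := h.exists_shapes hP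
  have hIeq : indexShape P w = translate e E := eventualShape_eq hI
  have hCeq : coeffShape P w = translate e (E ∪ P) := eventualShape_eq hC
  have hne : {m : ℕ | ∃ v : Cell, translate v (indexShape P w) ⊆ Sh P w m}.Nonempty := by
    refine ⟨R, (R : ℤ) • d - e, fun c hc => ?_⟩
    rw [mem_translate, hIeq, mem_translate] at hc
    have e1 : c - ((R : ℤ) • d - e) - e = c - (R : ℤ) • d := by module
    rw [e1, ← hE R le_rfl] at hc
    exact h.mem_Sh_iff.2 (mem_edge.1 hc).1
  have hleast : IsLeast {m : ℕ | ∃ v : Cell, translate v (indexShape P w) ⊆ Sh P w m}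
      (minPeriods P w) := ⟨Nat.sInf_mem hne, fun _ hm => Nat.sInf_le hm⟩
  refine ⟨hIeq ▸ hI, hCeq ▸ hC, hleast, ?_⟩
  obtain ⟨v, hv⟩ := hleast.1
  -- The translate provided by minimality shows that the corner is stable from `minPeriods P w` on.
  have hedge := fun n => h.edge_eq_of_translate_subset (n := n) hR hE (v := e + v)
    (fun c hc => hv (by
      rw [mem_translate, hIeq, mem_translate, ← add_assoc, add_sub_cancel_right,
        add_sub_cancel_right]
      exact hc))
  have key : ∀ k : ℕ, ∀ σ, (transferMatrix P w ^ k).mulVec (initialVector P w) σ =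
      (Nat.card {ξ : SYT (Sh P w (minPeriods P w + k)) // BottomIndexIso ξ σ} : ℝ) := by
    intro k
    induction k with
    | zero =>
      intro σ
      simp [initialVector]
    | succ k ih =>
      intro σ
      rw [pow_succ', ← Matrix.mulVec_mulVec]
      -- The shapes are generalized to `J` and `K` because they occur in the index types; the
      -- equations can then be substituted.
      have hstep : ∀ (J K : Shape), J = translate e E → K = translate e (E ∪ P) → ∀ σ : SYT J,
          Nat.card {ξ : SYT (Sh P w (minPeriods P w + k + 1)) // BottomIndexIso ξ σ} =
          ∑ σ' : SYT J, Nat.card {τ : SYT K // TopIndexIso τ σ' ∧ BottomIndexIso τ σ} *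
            Nat.card {ξ : SYT (Sh P w (minPeriods P w + k)) // BottomIndexIso ξ σ'} := by
        rintro J K rfl rfl σ
        have h1 := hedge (minPeriods P w + k) (by omega)
        exact h.card_bottomIndexIso_succ (by omega) h1.2 (hedge _ (by omega)).2 σ
      rw [← add_assoc, hstep _ _ hIeq hCeq σ]
      simp only [Matrix.mulVec, dotProduct] at ih ⊢
      push_cast
      refine Finset.sum_congr rfl fun σ' _ => ?_
      rw [ih σ']
      rfl
  intro n hn
  obtain ⟨k, rfl⟩ := Nat.exists_eq_add_of_le hn
  rw [Nat.add_sub_cancel_left, dotProduct]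
  simp only [key, onesVector, one_mul]
  -- Each tableau has exactly one index tableau, so the fibres partition all tableaux; this is the
  -- pairing with the all-ones vector.
  have htotal : ∀ J : Shape, J = translate e E → Nat.card (SYT (Sh P w (minPeriods P w + k))) =
      ∑ σ : SYT J, Nat.card {ξ : SYT (Sh P w (minPeriods P w + k)) // BottomIndexIso ξ σ} := by
    rintro J rfl
    have h1 := hedge (minPeriods P w + k) (by omega)
    have hq : ∀ c ∈ translate e E,
        c + (((minPeriods P w + k : ℕ) : ℤ) • d - e) ∈ Sh P w (minPeriods P w + k) := fun c hc => by
      have e1 : c + (((minPeriods P w + k : ℕ) : ℤ) • d - e) -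
        ((minPeriods P w + k : ℕ) : ℤ) • d = c - e := by module
      rw [h.mem_Sh_iff, e1]
      rw [mem_translate, ← h1.2] at hc
      exact (mem_edge.1 hc).1
    simp only [h.bottomIndexIso_Sh_iff (by omega) h1.2 hq]
    rw [← Nat.card_sigma]
    exact Nat.card_congr (Equiv.sigmaFiberEquiv (SYT.pull _ hq)).symm
  rw [numSYT, htotal _ hIeq]
  push_cast
  rfl
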